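/- For each $n$ let $X=X_n$ be a (non-random) $n\times p_n$ real matrix, let $\beta^*=\beta^*_n\in\mathbb R^{p_n}$ have exactly $s=s_n$ nonzero entries, and let $\sigma^*>0$ be fixed. Data $y=X\beta^*+\sigma^*\varepsilon$ with $\varepsilon\sim N(0,I_n)$ are observed, and $P^*$ denotes their law. For $\xi\subset\{1,\dots,p_n\}$ let $X_\xi$ be the matrix of the columns of $X$ indexed by $\xi$. Assume: ($A_1$) all entries of $X$ are bounded by $1$ in absolute value; $n=O(p_n)$; and there are integers $\bar p=\bar p_n$ with $s=o(\bar p)$ and a fixed constant $\lambda_0>0$ such that, for all large $n$, $\lambda_{\min}(X_\xi^TX_\xi)\ge n\lambda_0$ for every $\xi$ with $|\xi|\le\bar p$. ($A_2$) $s\log p_n=o(n)$; and there are a nondecreasing sequence $E_n$ and a fixed $\gamma_3\in(0,1)$ with $\max_j|\beta^*_j/\sigma^*|\le\gamma_3E_n$ for all large $n$. The prior on $(\beta,\sigma^2)$ is $\sigma^2\sim\mathrm{IG}(a_0,b_0)$ with fixed $a_0,b_0>0$ and, given $\sigma^2$, $\beta$ has density $\prod_{j=1}^{p_n}\sigma^{-1}g_\lambda(\beta_j/\sigma)$,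 where $g_\lambda$ is a probability density on $\mathbb R$ that may depend on $n$. Let $\pi(\cdot\mid D_n)$ be the posterior distribution given $D_n=(X,y)$ under the Gaussian likelihood of $y\sim N(X\beta,\sigma^2I_n)$. Suppose that for some constant $u>0$ and some sequence $a_n\asymp\sqrt{s\log p_n/n}/p_n$ (the ratio is bounded away from $0$ and $\infty$ for large $n$), for all large $n$, $$1-\int_{-a_n}^{a_n}g_\lambda(x)\,dx\le p_n^{-(1+u)},\qquad \inf_{x\in[-E_n,E_n]}g_\lambda(x)>0,$$ and $-\log\bigl(\inf_{x\in[-E_n,E_n]}g_\lambda(x)\bigr)=O(\log p_n)$. Then there is $M_0>0$ such that for every constant $M\ge M_0$, with $\epsilon_n=M\sqrt{s\log p_n/n}$, there are constants $c_1,c_2,c_3>0$ such that for all sufficiently large $n$, $$P^*\Bigl(\pi\bigl(\|\beta-\beta^*\|_2\ge c_1\sigma^*\epsilon_n\mid D_n\bigr)\ge e^{-c_2n\epsilon_n^2}\Bigr)\le e^{-c_3n\epsilon_n^2}$$ and $$P^*\Bigl(\pi\bigl(\|\beta-\beta^*\|_1\ge c_1\sqrt s\,\sigma^*\epsilon_n\mid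 D_n\bigr)\ge e^{-c_2n\epsilon_n^2}\Bigr)\le e^{-c_3n\epsilon_n^2}.$$ -/

import Mathlib

open MeasureTheory ProbabilityTheory Filter Asymptotics
open scoped ENNReal Matrix

namespace ShrinkageRegression

/-- The Euclidean (`L₂`) norm of a real vector. -/
noncomputable def l2norm {m : ℕ} (v : Fin m → ℝ) : ℝ := √(∑ j, v j ^ 2)

/-- The `L₁` norm of a real vector. -/
noncomputable def l1norm {m : ℕ} (v : Fin m → ℝ) : ℝ := ∑ j, |v j|

/-- The number of nonzero entries of a vector (the size of the true model). -/
noncomputable def sparsity {m : ℕ} (v : Fin m → ℝ) : ℕ := {j : Fin m | v j ≠ 0}.ncard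

/-- The sub-design matrix made of the columns indexed by `ξ`. -/
def subDesign {n p : ℕ} (X : Matrix (Fin n) (Fin p) ℝ) (ξ : Finset (Fin p)) :
    Matrix (Fin n) ξ ℝ := X.submatrix id Subtype.val

/-- The smallest eigenvalue of the square matrix `A` is at least `c` (true when `A` is empty). -/
def MinEigenvalueGE {ι : Type*} [Fintype ι] [DecidableEq ι] (A : Matrix ι ι ℝ) (c : ℝ) : Prop :=
  ∀ μ : ℝ, Module.End.HasEigenvalue (Matrix.toLin' A) μ → c ≤ μ

/-- The law of `y = X β + σ ε` with `ε ~ N(0, Iₙ)`. -/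
noncomputable def dataLaw {n p : ℕ} (X : Matrix (Fin n) (Fin p) ℝ) (β : Fin p → ℝ) (σ : ℝ) :
    Measure (Fin n → ℝ) :=
  (Measure.pi fun _ : Fin n => gaussianReal 0 1).map fun e => X *ᵥ β + σ • e

/-- The density of the inverse-gamma distribution with shape `a` and scale `b`. -/
noncomputable def invGammaPDF (a b t : ℝ) : ℝ :=
  if 0 < t then b ^ a / Real.Gamma a * t ^ (-(a + 1)) * Real.exp (-(b / t)) else 0

/-- The prior of `θ = (β, σ²)`: `σ² ~ IG(a, b)` and, given `σ²`, the entries of `β` are independent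
with density `x ↦ g (x / σ) / σ`. -/
noncomputable def prior (p : ℕ) (a b : ℝ) (g : ℝ → ℝ) : Measure ((Fin p → ℝ) × ℝ) :=
  (volume : Measure ((Fin p → ℝ) × ℝ)).withDensity fun θ =>
    ENNReal.ofReal (invGammaPDF a b θ.2 * ∏ j, g (θ.1 j / √θ.2) / √θ.2)

/-- The likelihood of `θ = (β, σ²)` at `y`: the density of `N(X β, σ² Iₙ)`. -/
noncomputable def likelihood {n p : ℕ} (X : Matrix (Fin n) (Fin p) ℝ) (y : Fin n → ℝ)
    (θ : (Fin p → ℝ) × ℝ) : ℝ≥0∞ :=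
  ENNReal.ofReal ((√(2 * Real.pi * θ.2))⁻¹ ^ n *
    Real.exp (-(l2norm (y - X *ᵥ θ.1) ^ 2 / (2 * θ.2))))

/-- The posterior distribution of `θ = (β, σ²)`, the normalized product of likelihood and prior. -/
noncomputable def posterior {n p : ℕ} (X : Matrix (Fin n) (Fin p) ℝ) (a b : ℝ) (g : ℝ → ℝ)
    (y : Fin n → ℝ) : Measure ((Fin p → ℝ) × ℝ) :=
  (∫⁻ θ, likelihood X y θ ∂(prior p a b g))⁻¹ • (prior p a b g).withDensity (likelihood X y)

/-- The contraction rate `M √(s log p / n)`. -/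
noncomputable def rate (M : ℝ) (n p s : ℕ) : ℝ := M * √(s * Real.log p / n)

end ShrinkageRegression

/-! Put `ℓ = s log p`. Numerator and denominator of the posterior are both compared with one
reference value: with `R` the residual sum of squares at the true coefficients, the peak over `t` of
the Gaussian likelihood with variance `t` and residual `R`, attained at `t = R / n`. This peak
cancels in the ratio, and since it dominates every variance (`gaussKernel_le_peak`), small values of
`σ²` need no separate treatment.

Denominator: let `σ²` lie in a window of relative width `1 / n` above `R / n`, and every rescaled
coefficient within `a n` of its true value. There the likelihood is at least the peak times `exp
(-O(ℓ))` (`le_likelihood_of_close`), and the prior mass is at least `exp (-O(ℓ))`: each of the `s`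
signals costs a power of `p` by thickness of the prior, while the `p` concentration factors together
cost at most a factor 2, because `p * p ^ (-(1 + u))` is small (`le_prior_close`, `exp_le_mass`).

Numerator, in three pieces. At least `K s` rescaled coefficients exceed `a n`: the prior mass is
`O(p ^ (-u K s))`, and the likelihood ratio against the truth has mean one, so Markov's inequality
applies (`stdGauss_lintegral_likelihood_ge_le`). Variance above `4 σ²`: the likelihood is below `exp
(-n / 20)` times the peak, whatever `β`. Otherwise the error `β - βs` is a `(K + 1) s`-sparse vector
`v` plus a remainder of small `L₁` norm. If `β` is far from `βs`, the eigenvalue condition makes `‖X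
v‖²` a large multiple of `ℓ σ²`, the noise bound uniform over sparse vectors
(`stdGauss_sparse_dot_le`) absorbs the cross term, and the likelihood is at most `exp (-C₃ ℓ)` times
the peak (`likelihood_le_of_far`). Both norms are covered at once, since `‖v‖₁ ≤ √((K + 1) s) ‖v‖₂`.

The constants are not circular: the cost of the denominator fixes `C₃`, then `C₃` fixes `K`, `K`
fixes the noise level `C₀`, and these fix `A` and the separation `H`. -/

namespace ShrinkageRegression

/-! ### Product integrals -/

/-- Tonelli's theorem for a product of functions of separate variables. -/
theorem lintegral_pi_prod {n : ℕ} (μ : Fin n → Measure ℝ) [∀ i, SigmaFinite (μ i)]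
    (f : Fin n → ℝ → ℝ≥0∞) (hf : ∀ i, Measurable (f i)) :
    ∫⁻ x, ∏ i, f i (x i) ∂(Measure.pi μ) = ∏ i, ∫⁻ t, f i t ∂(μ i) := by
  induction n with
  | zero => simp
  | succ n ih =>
    have hmp := (measurePreserving_piFinSuccAbove μ 0).symm
    rw [← hmp.lintegral_comp_emb (MeasurableEquiv.measurableEmbedding _), Fin.prod_univ_succ]
    have h1 : ∀ z : ℝ × (Fin n → ℝ),
        ∏ i, f i ((MeasurableEquiv.piFinSuccAbove (fun _ : Fin (n + 1) => ℝ) 0).symm z i)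
          = f 0 z.1 * ∏ i : Fin n, f i.succ (z.2 i) := by
      intro z
      rw [Fin.prod_univ_succ]
      simp [MeasurableEquiv.piFinSuccAbove]
    simp_rw [h1]
    rw [lintegral_prod_mul (f := f 0) (g := fun z : Fin n → ℝ => ∏ i : Fin n, f i.succ (z i))
      (hf 0).aemeasurable
      (Finset.measurable_prod _ fun i _ => (hf i.succ).comp (measurable_pi_apply i)).aemeasurable]
    congr 1
    simpa using ih (fun i => μ i.succ) (fun i => f i.succ) fun i => hf _

/-! ### Gaussian moment generating functions -/

/-- The standard Gaussian measure on `ℝⁿ`. -/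
noncomputable abbrev stdGauss (n : ℕ) : Measure (Fin n → ℝ) :=
  Measure.pi fun _ : Fin n => gaussianReal 0 1

theorem lintegral_exp_mul_gaussian (t : ℝ) :
    ∫⁻ x, ENNReal.ofReal (Real.exp (t * x)) ∂(gaussianReal 0 1)
      = ENNReal.ofReal (Real.exp (t ^ 2 / 2)) := by
  rw [← ofReal_integral_eq_lintegral_ofReal (integrable_exp_mul_gaussianReal t)
    (ae_of_all _ fun x => (Real.exp_pos _).le)]
  have := congrFun (mgf_id_gaussianReal (μ := 0) (v := 1)) t
  simp only [mgf, id] at this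
  rw [this]; simp

/-- The integral is exactly `(1 - 2c) ^ (-1/2)`. A second-order bound for `log (1 - 2c)` gives a
form valid for both signs of `c`, hence for both tails of the chi-square. -/
theorem lintegral_exp_sq_gaussian {c : ℝ} (hc : |c| ≤ 1 / 4) :
    ∫⁻ x, ENNReal.ofReal (Real.exp (c * x ^ 2)) ∂(gaussianReal 0 1)
      ≤ ENNReal.ofReal (Real.exp (c + 4 * c ^ 2)) := by
  have hc' := abs_le.1 hc
  rw [gaussianReal_of_var_ne_zero 0 (one_ne_zero), lintegral_withDensity_eq_lintegral_mul _
    (measurable_gaussianPDF 0 1) (by fun_prop)]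
  have h1 : ∀ x : ℝ, (gaussianPDF 0 1 * fun x => ENNReal.ofReal (Real.exp (c * x ^ 2))) x
      = ENNReal.ofReal ((√(2 * Real.pi))⁻¹ * Real.exp (-(1 / 2 - c) * x ^ 2)) := by
    intro x
    simp only [Pi.mul_apply, gaussianPDF, gaussianPDFReal]
    rw [← ENNReal.ofReal_mul (by positivity), mul_assoc, ← Real.exp_add]
    congr 3
    · simp
    · simp; ring
  simp_rw [h1]
  rw [← ofReal_integral_eq_lintegral_ofReal
    ((integrable_exp_neg_mul_sq (by linarith)).const_mul _) (ae_of_all _ fun x => by positivity),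
    integral_const_mul, integral_gaussian]
  apply ENNReal.ofReal_le_ofReal
  have hpi := Real.pi_pos
  have h2 : (√(2 * Real.pi))⁻¹ * √(Real.pi / (1 / 2 - c)) = √((1 - 2 * c)⁻¹) := by
    rw [← Real.sqrt_inv, ← Real.sqrt_mul (by positivity)]
    congr 1
    have : (1 / 2 - c) ≠ 0 := by linarith
    have : (1 - 2 * c) ≠ 0 := by linarith
    field_simp
  rw [h2]
  have hpos : 0 < 1 - 2 * c := by linarith
  apply Real.sqrt_le_iff.2 ⟨(Real.exp_pos _).le, ?_⟩
  rw [← Real.exp_nat_mul, inv_le_comm₀ hpos (Real.exp_pos _), ← Real.exp_neg,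
    ← Real.le_log_iff_exp_le hpos]
  have hx : |2 * c| ≤ 1 / 2 := abs_le.2 ⟨by linarith, by linarith⟩
  -- Taylor remainder after the linear term: `|log (1 - x) + x| ≤ x² / (1 - |x|) ≤ 2 x²` at `x =
  -- 2c`.
  have h3 := Real.abs_log_sub_add_sum_range_le (x := 2 * c) (by linarith) 1
  have h4 : |2 * c| ^ 2 / (1 - |2 * c|) ≤ 2 * (2 * c) ^ 2 := by
    rw [div_le_iff₀ (by linarith), sq_abs]
    nlinarith [sq_nonneg (2 * c)]
  simp only [Finset.sum_range_one] at h3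
  have := (abs_le.1 (h3.trans h4)).1
  norm_num at this ⊢
  linarith

/-! ### Tail bounds for Gaussian vectors -/

theorem lintegral_exp_dot_stdGauss {n : ℕ} (v : Fin n → ℝ) :
    ∫⁻ e, ENNReal.ofReal (Real.exp (v ⬝ᵥ e)) ∂(stdGauss n)
      = ENNReal.ofReal (Real.exp ((v ⬝ᵥ v) / 2)) := by
  have h : ∀ e : Fin n → ℝ, ENNReal.ofReal (Real.exp (v ⬝ᵥ e))
      = ∏ i, ENNReal.ofReal (Real.exp (v i * e i)) := by
    intro e
    rw [← ENNReal.ofReal_prod_of_nonneg fun i _ => (Real.exp_pos _).le, ← Real.exp_sum]; rfl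
  simp_rw [h]
  rw [lintegral_pi_prod (fun _ => gaussianReal 0 1)
    (fun i x => ENNReal.ofReal (Real.exp (v i * x))) fun i => by fun_prop]
  simp_rw [lintegral_exp_mul_gaussian]
  rw [← ENNReal.ofReal_prod_of_nonneg fun i _ => (Real.exp_pos _).le, ← Real.exp_sum,
    dotProduct, Finset.sum_div]
  simp_rw [sq]

theorem lintegral_exp_normSq_stdGauss {n : ℕ} {c : ℝ} (hc : |c| ≤ 1 / 4) :
    ∫⁻ e, ENNReal.ofReal (Real.exp (c * (e ⬝ᵥ e))) ∂(stdGauss n)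
      ≤ ENNReal.ofReal (Real.exp (n * (c + 4 * c ^ 2))) := by
  have h : ∀ e : Fin n → ℝ, ENNReal.ofReal (Real.exp (c * (e ⬝ᵥ e)))
      = ∏ i, ENNReal.ofReal (Real.exp (c * e i ^ 2)) := by
    intro e
    rw [← ENNReal.ofReal_prod_of_nonneg fun i _ => (Real.exp_pos _).le, ← Real.exp_sum,
      ← Finset.mul_sum]
    simp [dotProduct, sq]
  simp_rw [h]
  rw [lintegral_pi_prod (fun _ => gaussianReal 0 1)
    (fun i x => ENNReal.ofReal (Real.exp (c * x ^ 2))) fun i => by fun_prop]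
  refine (Finset.prod_le_prod' fun i _ => lintegral_exp_sq_gaussian hc).trans ?_
  rw [Finset.prod_const, Finset.card_univ, Fintype.card_fin, Real.exp_nat_mul,
    ENNReal.ofReal_pow (Real.exp_pos _).le]

/-- Chernoff's bound. -/
theorem measure_ge_le_exp {Ω : Type*} [MeasurableSpace Ω] (μ : Measure Ω) {f : Ω → ℝ}
    (hf : Measurable f) (t B : ℝ)
    (hB : ∫⁻ x, ENNReal.ofReal (Real.exp (f x)) ∂μ ≤ ENNReal.ofReal (Real.exp B)) :
    μ {x | t ≤ f x} ≤ ENNReal.ofReal (Real.exp (B - t)) := by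
  have h1 : {x | t ≤ f x} ⊆ {x | ENNReal.ofReal (Real.exp t) ≤ ENNReal.ofReal (Real.exp (f x))} :=
    fun x hx => ENNReal.ofReal_le_ofReal (Real.exp_le_exp.2 hx)
  refine (measure_mono h1).trans ((meas_ge_le_lintegral_div (by fun_prop)
    (by simp [Real.exp_pos]) ENNReal.ofReal_ne_top).trans ?_)
  rw [Real.exp_sub, ENNReal.ofReal_div_of_pos (Real.exp_pos t)]
  gcongr

theorem measurable_dot {n : ℕ} (v : Fin n → ℝ) : Measurable fun e : Fin n → ℝ => v ⬝ᵥ e := by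
  unfold dotProduct; fun_prop

theorem measurable_dot_self {n : ℕ} : Measurable fun e : Fin n → ℝ => e ⬝ᵥ e := by
  unfold dotProduct; fun_prop

/-- Chernoff with slope `2√ℓ / r`: the threshold becomes `4ℓ` and the log-moment is at most `2ℓ`.
The sign `c = ±1` treats the two tails together. -/
theorem stdGauss_dot_ge_le {n : ℕ} (v : Fin n → ℝ) {r ℓ : ℝ} (hr : 0 < r) (hv : v ⬝ᵥ v ≤ r ^ 2)
    (hℓ : 0 ≤ ℓ) :
    stdGauss n {e | 2 * r * √ℓ ≤ |v ⬝ᵥ e|} ≤ 2 * ENNReal.ofReal (Real.exp (-(2 * ℓ))) := by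
  have key : ∀ c : ℝ, c ^ 2 = 1 → stdGauss n {e | 4 * ℓ ≤ ((c * (2 * √ℓ / r)) • v) ⬝ᵥ e} ≤
      ENNReal.ofReal (Real.exp (-(2 * ℓ))) := by
    intro c hc
    have h0 := lintegral_exp_dot_stdGauss ((c * (2 * √ℓ / r)) • v)
    have h1 := measure_ge_le_exp (stdGauss n) (measurable_dot ((c * (2 * √ℓ / r)) • v))
      (4 * ℓ) (2 * ℓ) (by
        rw [h0]
        apply ENNReal.ofReal_le_ofReal
        apply Real.exp_le_exp.2
        rw [smul_dotProduct, dotProduct_smul, smul_eq_mul, smul_eq_mul]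
        have : c * (2 * √ℓ / r) * (c * (2 * √ℓ / r) * v ⬝ᵥ v) / 2
            = 2 * ℓ * (v ⬝ᵥ v / r ^ 2) := by
          have := Real.sq_sqrt hℓ
          field_simp
          rw [hc, this]; ring
        rw [this]
        have : v ⬝ᵥ v / r ^ 2 ≤ 1 := (div_le_one (by positivity)).2 hv
        nlinarith)
    convert h1 using 4
    ring
  have hsub : {e : Fin n → ℝ | 2 * r * √ℓ ≤ |v ⬝ᵥ e|} ⊆
      {e | 4 * ℓ ≤ ((1 * (2 * √ℓ / r)) • v) ⬝ᵥ e} ∪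
      {e | 4 * ℓ ≤ ((-1 * (2 * √ℓ / r)) • v) ⬝ᵥ e} := by
    intro e he
    simp only [Set.mem_ofPred_eq, Set.mem_union, smul_dotProduct, smul_eq_mul] at he ⊢
    have hs : 0 ≤ 2 * √ℓ / r := by positivity
    have h4 : 2 * √ℓ / r * (2 * r * √ℓ) = 4 * ℓ := by
      have := Real.mul_self_sqrt hℓ
      field_simp
      linear_combination 4 * this
    rcases le_abs.1 he with h | h
    · left; nlinarith [mul_le_mul_of_nonneg_left h hs]
    · right; nlinarith [mul_le_mul_of_nonneg_left h hs]
  refine (measure_mono hsub).trans ((measure_union_le _ _).trans ?_)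
  rw [two_mul (ENNReal.ofReal _)]
  exact add_le_add (key 1 (by norm_num)) (key (-1) (by norm_num))

theorem stdGauss_normSq_le {n : ℕ} {δ : ℝ} (hδ0 : 0 < δ) (hδ : δ ≤ 1) :
    stdGauss n {e | δ * n ≤ |e ⬝ᵥ e - n|} ≤
      2 * ENNReal.ofReal (Real.exp (-(δ ^ 2 / 16 * n))) := by
  -- The slope `c = ±δ / 8` leaves `4c² - δ² / 8 = -δ² / 16` per coordinate.
  have key : ∀ c : ℝ, |c| ≤ 1 / 8 * δ → c ^ 2 = (δ / 8) ^ 2 →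
      stdGauss n {e | c * n + δ ^ 2 / 8 * n ≤ c * (e ⬝ᵥ e)} ≤
      ENNReal.ofReal (Real.exp (-(δ ^ 2 / 16 * n))) := by
    intro c hc hc2
    have h1 := measure_ge_le_exp (stdGauss n) (measurable_dot_self.const_mul c)
      (c * n + δ ^ 2 / 8 * n) _ (lintegral_exp_normSq_stdGauss (by linarith))
    convert h1 using 3
    rw [hc2]; ring
  have hsub : {e : Fin n → ℝ | δ * n ≤ |e ⬝ᵥ e - n|} ⊆
      {e | δ / 8 * n + δ ^ 2 / 8 * n ≤ δ / 8 * (e ⬝ᵥ e)} ∪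
      {e | -(δ / 8) * n + δ ^ 2 / 8 * n ≤ -(δ / 8) * (e ⬝ᵥ e)} := by
    intro e he
    simp only [Set.mem_ofPred_eq, Set.mem_union] at he ⊢
    rcases le_abs.1 he with h | h
    · left; nlinarith
    · right; nlinarith
  refine (measure_mono hsub).trans ((measure_union_le _ _).trans ?_)
  rw [two_mul]
  exact add_le_add (key (δ / 8) (by rw [abs_of_pos] <;> linarith) rfl)
    (key (-(δ / 8)) (by rw [abs_neg, abs_of_pos] <;> linarith) (by ring))

/-- The squared length of the projection of a Gaussian vector on an orthonormal family has
exponential tails. -/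
theorem stdGauss_projection_le {n d : ℕ} (b : Fin d → Fin n → ℝ)
    (hb : ∀ i j, b i ⬝ᵥ b j = if i = j then 1 else 0) (t : ℝ) :
    stdGauss n {e | t ≤ ∑ i, (b i ⬝ᵥ e) ^ 2} ≤ ENNReal.ofReal (Real.exp (d / 2 - t / 4)) := by
  have hr : (√(1 / 2)) ^ 2 = (1 / 2 : ℝ) := Real.sq_sqrt (by norm_num)
  set r : ℝ := √(1 / 2)
  have hlin : ∀ (z : Fin d → ℝ) (e : Fin n → ℝ),
      (r • ∑ i, z i • b i) ⬝ᵥ e = (r • fun i => b i ⬝ᵥ e) ⬝ᵥ z := by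
    intro z e
    rw [smul_dotProduct, smul_dotProduct, sum_dotProduct]
    congr 1
    exact Finset.sum_congr rfl fun i _ => by rw [smul_dotProduct, smul_eq_mul, mul_comm]
  have hsq : ∀ z : Fin d → ℝ, (r • ∑ i, z i • b i) ⬝ᵥ (r • ∑ i, z i • b i) = 1 / 2 * (z ⬝ᵥ z) := by
    intro z
    simp only [smul_dotProduct, dotProduct_smul, sum_dotProduct, dotProduct_sum, smul_eq_mul, hb]
    simp only [mul_ite, mul_one, mul_zero, Finset.sum_ite_eq', Finset.mem_univ, if_true,
      ← hr, dotProduct, Finset.mul_sum]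
    exact Finset.sum_congr rfl fun i _ => by ring
  -- Linearization by an auxiliary Gaussian `z`: `exp (S / 4)` is the mean over `z` of an
  -- exponential linear in `e`. After swapping the integrals, the one over `e` gives `exp (‖z‖² /
  -- 4)` by orthonormality, and the one over `z` at most `exp (d (1/4 + 4/16))`.
  have hmain : ∫⁻ e, ENNReal.ofReal (Real.exp (1 / 4 * ∑ i, (b i ⬝ᵥ e) ^ 2)) ∂(stdGauss n)
      ≤ ENNReal.ofReal (Real.exp (d / 2)) := by
    have h1 : ∀ e : Fin n → ℝ, ENNReal.ofReal (Real.exp (1 / 4 * ∑ i, (b i ⬝ᵥ e) ^ 2)) =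
        ∫⁻ z, ENNReal.ofReal (Real.exp ((r • ∑ i, z i • b i) ⬝ᵥ e)) ∂(stdGauss d) := by
      intro e
      simp_rw [hlin]
      rw [lintegral_exp_dot_stdGauss]
      congr 2
      have h2 : (fun i => b i ⬝ᵥ e) ⬝ᵥ (fun i => b i ⬝ᵥ e) = ∑ i, (b i ⬝ᵥ e) ^ 2 :=
        Finset.sum_congr rfl fun i _ => (sq _).symm
      rw [smul_dotProduct, dotProduct_smul, smul_eq_mul, smul_eq_mul, h2]
      linear_combination (-1 / 2 * ∑ i, (b i ⬝ᵥ e) ^ 2) * hr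
    simp_rw [h1]
    rw [lintegral_lintegral_swap]
    · simp_rw [lintegral_exp_dot_stdGauss, hsq]
      have := lintegral_exp_normSq_stdGauss (n := d) (c := 1 / 4) (by norm_num [abs_of_pos])
      refine le_trans (le_of_eq ?_) (this.trans (le_of_eq ?_))
      · congr; ext z; congr 2; ring
      · congr 2; ring
    · apply Measurable.aemeasurable
      simp only [dotProduct, Pi.smul_apply, Finset.sum_apply, smul_eq_mul]
      fun_prop
  have h2 := measure_ge_le_exp (stdGauss n) (f := fun e => 1 / 4 * ∑ i, (b i ⬝ᵥ e) ^ 2)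
    (by unfold dotProduct; fun_prop) (t / 4) _ hmain
  refine le_trans (measure_mono fun e he => ?_) h2
  simp only [Set.mem_ofPred_eq] at he ⊢
  linarith

/-! ### Sparse linear combinations of the columns -/

/-- Parseval and Cauchy–Schwarz in an orthonormal basis of the span of the `c i`. A supremum over
all coefficients `x` is thereby controlled by one projection length. The vectors may be dependent,
hence `d ≤ m`. -/
theorem exists_orthonormal_family {n m : ℕ} (c : Fin m → Fin n → ℝ) :
    ∃ (d : ℕ) (b : Fin d → Fin n → ℝ), d ≤ m ∧ (∀ i j, b i ⬝ᵥ b j = if i = j then 1 else 0) ∧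
      ∀ (x : Fin m → ℝ) (e : Fin n → ℝ), ((∑ i, x i • c i) ⬝ᵥ e) ^ 2 ≤
        ((∑ i, x i • c i) ⬝ᵥ (∑ i, x i • c i)) * ∑ i, (b i ⬝ᵥ e) ^ 2 := by
  let V : Submodule ℝ (EuclideanSpace ℝ (Fin n)) :=
    Submodule.span ℝ (Set.range fun i => WithLp.toLp 2 (c i))
  let B := stdOrthonormalBasis ℝ V
  have hin : ∀ x y : EuclideanSpace ℝ (Fin n), inner ℝ x y = y.ofLp ⬝ᵥ x.ofLp := by
    intro x y; simp [PiLp.inner_apply, dotProduct]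
  refine ⟨Module.finrank ℝ V, fun i => ((B i : V) : EuclideanSpace ℝ (Fin n)).ofLp, ?_, ?_, ?_⟩
  · have := finrank_range_le_card (R := ℝ) fun i => WithLp.toLp 2 (c i)
    rwa [Set.finrank, Fintype.card_fin] at this
  · intro i j
    rw [← hin, ← Submodule.coe_inner, orthonormal_iff_ite.1 B.orthonormal j i]
    simp [eq_comm]
  · intro x e
    set w := ∑ i, x i • c i with hw
    have hwV : WithLp.toLp 2 w ∈ V := by
      have : WithLp.toLp 2 w = ∑ i, x i • WithLp.toLp 2 (c i) := by
        rw [hw]; ext k; simp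
      rw [this]
      exact V.sum_mem fun i _ => V.smul_mem _ (Submodule.subset_span ⟨i, rfl⟩)
    let W : V := ⟨WithLp.toLp 2 w, hwV⟩
    have h1 : w = ∑ i, (inner ℝ (B i) W) • ((B i : V) : EuclideanSpace ℝ (Fin n)).ofLp := by
      have := congrArg (fun z : V => (z : EuclideanSpace ℝ (Fin n)).ofLp) (B.sum_repr' W)
      simpa using this.symm
    have h2 : w ⬝ᵥ w = ∑ i, (inner ℝ (B i) W) ^ 2 := by
      have h3 := B.sum_sq_norm_inner_right W
      simp only [Real.norm_eq_abs, sq_abs] at h3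
      rw [h3, ← real_inner_self_eq_norm_sq, Submodule.coe_inner, hin]
    rw [h2]
    have h4 : w ⬝ᵥ e = ∑ i, (inner ℝ (B i) W) *
        (((B i : V) : EuclideanSpace ℝ (Fin n)).ofLp ⬝ᵥ e) := by
      conv_lhs => rw [h1]
      simp [sum_dotProduct, smul_dotProduct]
    rw [h4]
    exact Finset.sum_mul_sq_le_sq_mul_sq _ _ _

theorem Finset.exists_fin_enum {p m : ℕ} {T : Finset (Fin p)} (hT : T.card ≤ m)
    (hne : T.Nonempty) : ∃ f : Fin m → Fin p, ∀ j ∈ T, ∃ i, f i = j := by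
  obtain ⟨j0, hj0⟩ := hne
  -- Indices beyond the cardinality of `T` take the default value `j0`; repetitions are harmless, as
  -- only surjectivity onto `T` matters.
  refine ⟨fun i => if h : (i : ℕ) < T.card then T.equivFin.symm ⟨i, h⟩ else j0, fun j hj => ?_⟩
  refine ⟨⟨T.equivFin ⟨j, hj⟩, lt_of_lt_of_le (Fin.is_lt _) hT⟩, ?_⟩
  simp

/-- Uniformly over `m`-sparse coefficient vectors `v`, the inner product of `X v` with Gaussian
noise is controlled by the length of `X v`. -/
theorem stdGauss_sparse_dot_le {n p : ℕ} (X : Matrix (Fin n) (Fin p) ℝ) (m : ℕ) {t : ℝ} :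
    stdGauss n {e | ∃ (T : Finset (Fin p)) (v : Fin p → ℝ), T.card ≤ m ∧ (∀ j ∉ T, v j = 0) ∧
        t * ((X *ᵥ v) ⬝ᵥ (X *ᵥ v)) < ((X *ᵥ v) ⬝ᵥ e) ^ 2} ≤
      (p : ℝ≥0∞) ^ m * ENNReal.ofReal (Real.exp (m / 2 - t / 4)) := by
  choose d b hd hb hdot using fun f : Fin m → Fin p =>
    exists_orthonormal_family (fun i => Xᵀ (f i))
  -- The union runs over the `p ^ m` maps `Fin m → Fin p` instead of over subsets; each supporting
  -- set is covered by the range of some map.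
  have hsub : {e | ∃ (T : Finset (Fin p)) (v : Fin p → ℝ), T.card ≤ m ∧ (∀ j ∉ T, v j = 0) ∧
        t * ((X *ᵥ v) ⬝ᵥ (X *ᵥ v)) < ((X *ᵥ v) ⬝ᵥ e) ^ 2} ⊆
      ⋃ f : Fin m → Fin p, {e | t ≤ ∑ i, (b f i ⬝ᵥ e) ^ 2} := by
    rintro e ⟨T, v, hT, hv, h⟩
    rcases T.eq_empty_or_nonempty with rfl | hne
    · have : v = 0 := funext fun j => hv j (by simp)
      simp [this] at h
    obtain ⟨f, hf⟩ := Finset.exists_fin_enum hT hne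
    have hspan : X *ᵥ v ∈ Submodule.span ℝ (Set.range fun i => Xᵀ (f i)) := by
      rw [Matrix.mulVec_eq_sum]
      refine Submodule.sum_mem _ fun j _ => ?_
      rw [op_smul_eq_smul]
      by_cases hj : j ∈ T
      · obtain ⟨i, rfl⟩ := hf j hj
        exact Submodule.smul_mem _ _ (Submodule.subset_span (Set.mem_range_self i))
      · simp [hv j hj]
    obtain ⟨x, hx⟩ := (Submodule.mem_span_range_iff_exists_fun ℝ).1 hspan
    have h1 := hdot f x e
    rw [hx] at h1
    refine Set.mem_iUnion.2 ⟨f, ?_⟩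
    have h2 : 0 ≤ (X *ᵥ v) ⬝ᵥ (X *ᵥ v) := by
      simpa [dotProduct] using Finset.sum_nonneg fun i _ => mul_self_nonneg ((X *ᵥ v) i)
    simp only [Set.mem_ofPred_eq]
    by_contra! hlt
    nlinarith [mul_le_mul_of_nonneg_left hlt.le h2]
  refine (measure_mono hsub).trans ((measure_iUnion_le _).trans ?_)
  rw [tsum_fintype]
  refine (Finset.sum_le_sum fun f _ => (stdGauss_projection_le (b f) (hb f) t).trans
    (ENNReal.ofReal_le_ofReal (Real.exp_le_exp.2 (?_ : _ ≤ (m : ℝ) / 2 - t / 4)))).trans ?_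
  · have : (d f : ℝ) ≤ m := by exact_mod_cast hd f
    linarith
  · simp

/-! ### The likelihood -/

theorem l2norm_sq {m : ℕ} (v : Fin m → ℝ) : l2norm v ^ 2 = v ⬝ᵥ v := by
  rw [l2norm, Real.sq_sqrt (Finset.sum_nonneg fun i _ => sq_nonneg _)]
  exact Finset.sum_congr rfl fun i _ => sq _

theorem measurable_likelihood {n p : ℕ} (X : Matrix (Fin n) (Fin p) ℝ) :
    Measurable fun z : (Fin n → ℝ) × ((Fin p → ℝ) × ℝ) => likelihood X z.1 z.2 := by
  unfold likelihood
  simp_rw [l2norm_sq]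
  simp only [dotProduct, Matrix.mulVec, Pi.sub_apply]
  fun_prop

/-- The weight is the reciprocal of the true likelihood, so this is the mean of a likelihood ratio
under the truth. Coordinatewise the integrand is the density of `N(-d i / σ, t / σ²)`. -/
theorem lintegral_likelihood_ratio {n p : ℕ} (X : Matrix (Fin n) (Fin p) ℝ) (βs : Fin p → ℝ)
    {σ : ℝ} (hσ : 0 < σ) (θ : (Fin p → ℝ) × ℝ) (hθ : 0 < θ.2) :
    ∫⁻ e, likelihood X (X *ᵥ βs + σ • e) θ *
      ENNReal.ofReal (√(2 * Real.pi * σ ^ 2) ^ n * Real.exp ((e ⬝ᵥ e) / 2)) ∂(stdGauss n) = 1 := by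
  obtain ⟨β, t⟩ := θ
  simp only at hθ
  set d : Fin n → ℝ := X *ᵥ βs - X *ᵥ β with hd
  have hpi := Real.pi_pos
  have h1 : ∀ e : Fin n → ℝ, likelihood X (X *ᵥ βs + σ • e) (β, t) *
      ENNReal.ofReal (√(2 * Real.pi * σ ^ 2) ^ n * Real.exp ((e ⬝ᵥ e) / 2)) =
      ∏ i, ENNReal.ofReal ((√(2 * Real.pi * t))⁻¹ * √(2 * Real.pi * σ ^ 2) *
        Real.exp (-((σ * e i + d i) ^ 2 / (2 * t)) + e i ^ 2 / 2)) := by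
    intro e
    rw [← ENNReal.ofReal_prod_of_nonneg fun i _ => by positivity, likelihood,
      ← ENNReal.ofReal_mul (by positivity), Finset.prod_mul_distrib, ← Real.exp_sum,
      Finset.prod_const, Finset.card_univ, Fintype.card_fin, mul_pow, Finset.sum_add_distrib,
      Real.exp_add, ← Finset.sum_div]
    have h2 : l2norm (X *ᵥ βs + σ • e - X *ᵥ β) ^ 2 = ∑ i, (σ * e i + d i) ^ 2 := by
      rw [l2norm_sq]
      refine Finset.sum_congr rfl fun i _ => ?_
      simp only [Pi.sub_apply, Pi.add_apply, Pi.smul_apply, smul_eq_mul, hd]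
      ring
    have h3 : e ⬝ᵥ e = ∑ i, e i ^ 2 := Finset.sum_congr rfl fun i _ => (sq _).symm
    simp only
    rw [h2, h3, Finset.sum_neg_distrib, ← Finset.sum_div]
    congr 1
    ring
  simp_rw [h1]
  rw [lintegral_pi_prod (fun _ => gaussianReal 0 1) (fun i x =>
    ENNReal.ofReal ((√(2 * Real.pi * t))⁻¹ * √(2 * Real.pi * σ ^ 2) *
        Real.exp (-((σ * x + d i) ^ 2 / (2 * t)) + x ^ 2 / 2))) fun i => by fun_prop]
  refine Finset.prod_eq_one fun i _ => ?_
  rw [gaussianReal_of_var_ne_zero 0 (one_ne_zero), lintegral_withDensity_eq_lintegral_mul _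
    (measurable_gaussianPDF 0 1) (by fun_prop)]
  have hpos : 0 < t / σ ^ 2 := by positivity
  have hv : (t / σ ^ 2).toNNReal ≠ 0 := (Real.toNNReal_pos.2 hpos).ne'
  rw [← lintegral_gaussianPDF_eq_one (-(d i / σ)) hv]
  refine lintegral_congr fun x => ?_
  simp only [Pi.mul_apply, gaussianPDF, gaussianPDFReal]
  rw [← ENNReal.ofReal_mul (by positivity)]
  congr 1
  have e1 : √(2 * Real.pi * σ ^ 2) = √(2 * Real.pi) * σ := by
    rw [Real.sqrt_mul (by positivity), Real.sqrt_sq hσ.le]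
  have e2 : √(2 * Real.pi * (t / σ ^ 2)) = √(2 * Real.pi * t) / σ := by
    rw [← mul_div_assoc, Real.sqrt_div (by positivity), Real.sqrt_sq hσ.le]
  simp only [NNReal.coe_one, mul_one, sub_zero, Real.coe_toNNReal _ hpos.le, sub_neg_eq_add]
  rw [e1, e2]
  have e3 : (√(2 * Real.pi))⁻¹ * √(2 * Real.pi) = 1 :=
    inv_mul_cancel₀ (by positivity)
  have e4 : -(x + d i / σ) ^ 2 / (2 * (t / σ ^ 2)) = -x ^ 2 / 2 +
      (-((σ * x + d i) ^ 2 / (2 * t)) + x ^ 2 / 2) := by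
    field_simp
    ring
  rw [e4, Real.exp_add (-x ^ 2 / 2)]
  calc _ = ((√(2 * Real.pi))⁻¹ * √(2 * Real.pi)) * (Real.exp (-x ^ 2 / 2) *
        ((√(2 * Real.pi * t))⁻¹ * σ *
        Real.exp (-((σ * x + d i) ^ 2 / (2 * t)) + x ^ 2 / 2))) := by ring
    _ = _ := by rw [e3, inv_div]; ring

/-! ### The prior -/

theorem measurable_invGammaPDF (a b : ℝ) : Measurable (invGammaPDF a b) := by
  unfold invGammaPDF
  exact Measurable.ite measurableSet_Ioi (by fun_prop) measurable_const

theorem invGammaPDF_nonneg {a b : ℝ} (ha : 0 < a) (hb : 0 < b) (t : ℝ) : 0 ≤ invGammaPDF a b t := by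
  unfold invGammaPDF
  split_ifs with h
  · have := Real.Gamma_pos_of_pos ha
    positivity
  · exact le_rfl

/-- The inverse-gamma density has finite mass. -/
theorem lintegral_invGammaPDF_lt_top {a b : ℝ} (ha : 0 < a) (hb : 0 < b) :
    ∫⁻ t, ENNReal.ofReal (invGammaPDF a b t) < ∞ := by
  have h1 : IntegrableOn (fun x : ℝ => x ^ (a - 1) * Real.exp (-b * x)) (Set.Ioi 0) := by
    have := integrableOn_rpow_mul_exp_neg_mul_rpow (p := 1) (s := a - 1) (b := b)
      (by linarith) one_pos hb
    simpa using this
  -- The substitution `t ↦ t⁻¹` reduces the claim to the Gamma integral.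
  have h2 := (integrableOn_Ioi_comp_rpow_iff' _ (by norm_num : (-1 : ℝ) ≠ 0)).2 h1
  have h3 : IntegrableOn (invGammaPDF a b) (Set.Ioi 0) := by
    refine (IntegrableOn.congr_fun (h2.const_mul (b ^ a / Real.Gamma a)) ?_ measurableSet_Ioi)
    intro t ht
    have ht' : (0:ℝ) < t := ht
    simp only [invGammaPDF, if_pos ht', smul_eq_mul]
    rw [← mul_assoc (t ^ _), ← Real.rpow_mul ht'.le, ← Real.rpow_add ht', mul_assoc, Real.rpow_neg_one]
    congr 3
    · ring
    · ring
  have h4 := h3.lintegral_lt_top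
  rwa [setLIntegral_eq_of_support_subset] at h4
  intro t ht
  by_contra h
  apply ht
  simp only [Set.mem_Ioi, not_lt] at h
  simp [invGammaPDF, not_lt.2 h]

theorem lintegral_comp_div {c : ℝ} (hc : 0 < c) {h : ℝ → ℝ≥0∞} (hh : Measurable h) :
    ∫⁻ x, h (x / c) * ENNReal.ofReal (1 / c) = ∫⁻ x, h x := by
  have hc' : c⁻¹ ≠ 0 := by positivity
  conv_rhs => rw [← Real.smul_map_volume_mul_left hc']
  rw [lintegral_smul_measure, lintegral_map hh (by fun_prop), lintegral_mul_const _ (by fun_prop),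
    abs_of_pos (by positivity), mul_comm, smul_eq_mul, one_div]
  simp_rw [div_eq_inv_mul]

/-- The law of a single rescaled coefficient. -/
noncomputable def coefLaw (g : ℝ → ℝ) : Measure ℝ :=
  volume.withDensity fun x => ENNReal.ofReal (g x)

theorem coefLaw_univ {g : ℝ → ℝ} (hg0 : ∀ x, 0 ≤ g x) (hg : ∫ x, g x = 1) :
    coefLaw g Set.univ = 1 := by
  have hi : Integrable g := by
    by_contra h
    rw [integral_undef h] at hg
    norm_num at hg
  rw [coefLaw, withDensity_apply _ MeasurableSet.univ, Measure.restrict_univ,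
    ← ofReal_integral_eq_lintegral_ofReal hi (ae_of_all _ hg0), hg, ENNReal.ofReal_one]

/-- The prior probability of a box, in which the rescaled coefficients lie in prescribed sets. -/
theorem prior_box {p : ℕ} {a b : ℝ} (ha : 0 < a) (hb : 0 < b) {g : ℝ → ℝ} (hg : Measurable g)
    (hg0 : ∀ x, 0 ≤ g x) {I : Set ℝ} (hI : MeasurableSet I) (C : Fin p → ℝ → Set ℝ)
    (hC : ∀ j, MeasurableSet {z : ℝ × ℝ | z.1 ∈ C j z.2}) :
    prior p a b g {θ | θ.2 ∈ I ∧ ∀ j, θ.1 j / √θ.2 ∈ C j θ.2} =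
      ∫⁻ t in I, ENNReal.ofReal (invGammaPDF a b t) * ∏ j, coefLaw g (C j t) := by
  have hCt : ∀ j t, MeasurableSet (C j t) := fun j t =>
    (measurable_id.prodMk measurable_const : Measurable fun x : ℝ => (x, t)) (hC j)
  have hmeas : MeasurableSet
      {θ : (Fin p → ℝ) × ℝ | θ.2 ∈ I ∧ ∀ j, θ.1 j / √θ.2 ∈ C j θ.2} := by
    refine (measurable_snd hI).inter ?_
    have : {θ : (Fin p → ℝ) × ℝ | ∀ j, θ.1 j / √θ.2 ∈ C j θ.2} =
        ⋂ j, (fun θ : (Fin p → ℝ) × ℝ => (θ.1 j / √θ.2, θ.2)) ⁻¹' {z : ℝ × ℝ | z.1 ∈ C j z.2} := by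
      ext; simp
    change MeasurableSet {θ : (Fin p → ℝ) × ℝ | ∀ j, θ.1 j / √θ.2 ∈ C j θ.2}
    rw [this]
    exact MeasurableSet.iInter fun j => (by fun_prop : Measurable _) (hC j)
  have hdens : Measurable fun θ : (Fin p → ℝ) × ℝ =>
      ENNReal.ofReal (invGammaPDF a b θ.2 * ∏ j, g (θ.1 j / √θ.2) / √θ.2) := by
    have := measurable_invGammaPDF a b
    fun_prop
  rw [prior, withDensity_apply _ hmeas, ← lintegral_indicator hmeas, Measure.volume_eq_prod,
    lintegral_prod_symm' _ (hdens.indicator hmeas), ← lintegral_indicator hI]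
  refine lintegral_congr fun t => ?_
  by_cases htI : t ∈ I
  swap
  · rw [Set.indicator_of_notMem htI, lintegral_eq_zero_iff' ]
    · refine ae_of_all _ fun x => Set.indicator_of_notMem (fun h => htI h.1) _
    · exact ((hdens.indicator hmeas).comp (measurable_id.prodMk measurable_const)).aemeasurable
  rw [Set.indicator_of_mem htI]
  -- For `t ≤ 0` the inverse-gamma factor vanishes on both sides. For `t > 0` the coefficients are
  -- conditionally independent and the factors `1 / √t` are the Jacobian of the rescaling.
  rcases le_or_gt t 0 with ht | ht
  · have h0 : invGammaPDF a b t = 0 := by simp [invGammaPDF, not_lt.2 ht]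
    rw [h0, ENNReal.ofReal_zero, zero_mul]
    have : ∀ x : Fin p → ℝ, Set.indicator
        {θ : (Fin p → ℝ) × ℝ | θ.2 ∈ I ∧ ∀ j, θ.1 j / √θ.2 ∈ C j θ.2}
        (fun θ => ENNReal.ofReal (invGammaPDF a b θ.2 * ∏ j, g (θ.1 j / √θ.2) / √θ.2)) (x, t)
          = 0 := by
      intro x
      rw [Set.indicator_apply_eq_zero]
      intro _
      simp [h0]
    simp_rw [this]
    simp
  · have hst : 0 < √t := Real.sqrt_pos.2 ht
    have h1 : ∀ x : Fin p → ℝ, Set.indicator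
        {θ : (Fin p → ℝ) × ℝ | θ.2 ∈ I ∧ ∀ j, θ.1 j / √θ.2 ∈ C j θ.2}
        (fun θ => ENNReal.ofReal (invGammaPDF a b θ.2 * ∏ j, g (θ.1 j / √θ.2) / √θ.2)) (x, t)
          = ENNReal.ofReal (invGammaPDF a b t) *
            ∏ j, ((C j t).indicator (fun z => ENNReal.ofReal (g z)) (x j / √t) *
              ENNReal.ofReal (1 / √t)) := by
      intro x
      by_cases hx : ∀ j, x j / √t ∈ C j t
      · rw [Set.indicator_of_mem (by exact ⟨htI, hx⟩),
          ENNReal.ofReal_mul (invGammaPDF_nonneg ha hb t),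
          ENNReal.ofReal_prod_of_nonneg fun j _ => div_nonneg (hg0 _) hst.le]
        congr 1
        refine Finset.prod_congr rfl fun j _ => ?_
        rw [Set.indicator_of_mem (hx j), ← ENNReal.ofReal_mul (hg0 _), mul_one_div]
      · rw [Set.indicator_of_notMem (fun h => hx h.2)]
        push Not at hx
        obtain ⟨j, hj⟩ := hx
        rw [Finset.prod_eq_zero (Finset.mem_univ j), mul_zero]
        rw [Set.indicator_of_notMem hj, zero_mul]
    simp_rw [h1]
    have hm : ∀ j, Measurable ((C j t).indicator fun z => ENNReal.ofReal (g z)) := fun j =>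
      (by fun_prop : Measurable fun z => ENNReal.ofReal (g z)).indicator (hCt j t)
    have hm' : ∀ j, Measurable fun x : ℝ => (C j t).indicator (fun z => ENNReal.ofReal (g z))
        (x / √t) * ENNReal.ofReal (1 / √t) := fun j => by
      exact ((hm j).comp (by fun_prop : Measurable fun x : ℝ => x / √t)).mul_const _
    rw [lintegral_const_mul' _ _ ENNReal.ofReal_ne_top, volume_pi,
      lintegral_pi_prod (fun _ => volume) (fun j x => (C j t).indicator
        (fun z => ENNReal.ofReal (g z)) (x / √t) * ENNReal.ofReal (1 / √t)) hm']
    congr 1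
    refine Finset.prod_congr rfl fun j _ => ?_
    rw [lintegral_comp_div hst (hm j), lintegral_indicator (hCt j t), coefLaw,
      withDensity_apply _ (hCt j t)]

theorem prior_univ_le {p : ℕ} {a b : ℝ} (ha : 0 < a) (hb : 0 < b) {g : ℝ → ℝ} (hg : Measurable g)
    (hg0 : ∀ x, 0 ≤ g x) (hg1 : ∫ x, g x = 1) :
    prior p a b g Set.univ = ∫⁻ t, ENNReal.ofReal (invGammaPDF a b t) := by
  have := prior_box (p := p) ha hb hg hg0 MeasurableSet.univ (fun _ _ => Set.univ)
    (fun j => by simp)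
  simpa [coefLaw_univ hg0 hg1] using this

theorem ae_prior_pos {p : ℕ} {a b : ℝ} (ha : 0 < a) (hb : 0 < b) {g : ℝ → ℝ} (hg : Measurable g)
    (hg0 : ∀ x, 0 ≤ g x) : ∀ᵐ θ ∂(prior p a b g), 0 < θ.2 := by
  have h := prior_box (p := p) ha hb hg hg0 measurableSet_Iic (I := Set.Iic 0)
    (fun _ _ => Set.univ) (fun j => by simp)
  have h0 : ∫⁻ t in Set.Iic (0:ℝ), ENNReal.ofReal (invGammaPDF a b t) *
      ∏ j : Fin p, coefLaw g Set.univ = 0 := by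
    refine setLIntegral_eq_zero measurableSet_Iic fun t ht => ?_
    simp [invGammaPDF, not_lt.2 (Set.mem_Iic.1 ht)]
  rw [h0] at h
  rw [ae_iff]
  simpa using h

/-- The prior probability that at least `k` rescaled coefficients exceed `r`. -/
theorem prior_many_large_le {p : ℕ} {a b : ℝ} (ha : 0 < a) (hb : 0 < b) {g : ℝ → ℝ}
    (hg : Measurable g) (hg0 : ∀ x, 0 ≤ g x) (hg1 : ∫ x, g x = 1) (r : ℝ) (k : ℕ) :
    prior p a b g {θ | k ≤ (Finset.univ.filter fun j => r < |θ.1 j / √θ.2|).card} ≤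
      (p * coefLaw g {z | r < |z|}) ^ k * ∫⁻ t, ENNReal.ofReal (invGammaPDF a b t) := by
  have hS : MeasurableSet {z : ℝ | r < |z|} := measurableSet_lt measurable_const (by fun_prop)
  -- Union bound over the `k`-subsets of coordinates, at most `p ^ k` in number.
  have hsub : {θ : (Fin p → ℝ) × ℝ |
      k ≤ (Finset.univ.filter fun j => r < |θ.1 j / √θ.2|).card} ⊆
      ⋃ T ∈ (Finset.univ : Finset (Fin p)).powersetCard k, {θ | θ.2 ∈ Set.univ ∧
        ∀ j, θ.1 j / √θ.2 ∈ if j ∈ T then {z | r < |z|} else Set.univ} := by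
    intro θ hθ
    obtain ⟨T, hT, hTc⟩ := Finset.exists_subset_card_eq hθ
    simp only [Set.mem_iUnion]
    refine ⟨T, Finset.mem_powersetCard.2 ⟨Finset.subset_univ _, hTc⟩, trivial, fun j => ?_⟩
    split_ifs with hj
    · exact (Finset.mem_filter.1 (hT hj)).2
    · trivial
  refine (measure_mono hsub).trans ((measure_biUnion_finset_le _ _).trans ?_)
  have hterm : ∀ T ∈ (Finset.univ : Finset (Fin p)).powersetCard k,
      prior p a b g {θ | θ.2 ∈ Set.univ ∧
        ∀ j, θ.1 j / √θ.2 ∈ if j ∈ T then {z | r < |z|} else Set.univ} =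
      (coefLaw g {z | r < |z|}) ^ k * ∫⁻ t, ENNReal.ofReal (invGammaPDF a b t) := by
    intro T hT
    have hTc := (Finset.mem_powersetCard.1 hT).2
    rw [prior_box ha hb hg hg0 MeasurableSet.univ
      (fun j _ => if j ∈ T then {z | r < |z|} else Set.univ)]
    · have : ∏ j, coefLaw g (if j ∈ T then {z | r < |z|} else Set.univ) =
          coefLaw g {z | r < |z|} ^ k := by
        have h2 : ∀ j, coefLaw g (if j ∈ T then {z | r < |z|} else Set.univ) =
            if j ∈ T then coefLaw g {z | r < |z|} else 1 := by
          intro j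
          split_ifs
          · rfl
          · exact coefLaw_univ hg0 hg1
        simp_rw [h2]
        rw [Finset.prod_ite_mem, Finset.univ_inter, Finset.prod_const, hTc]
      rw [this, Measure.restrict_univ, lintegral_mul_const _
        (measurable_invGammaPDF a b).ennreal_ofReal, mul_comm]
    · intro j
      by_cases hj : j ∈ T
      · simp only [hj, if_true]
        exact measurable_fst hS
      · simp [hj]
  rw [Finset.sum_congr rfl hterm, Finset.sum_const, Finset.card_powersetCard, Finset.card_univ,
    Fintype.card_fin, nsmul_eq_mul, mul_pow, ← mul_assoc]
  gcongr
  exact_mod_cast Nat.choose_le_pow p k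

/-! ### The profile likelihood -/

/-- The Gaussian likelihood with variance `t`, as a function of the residual sum of squares. -/
noncomputable def gaussKernel (n : ℕ) (t Q : ℝ) : ℝ :=
  (√(2 * Real.pi * t))⁻¹ ^ n * Real.exp (-(Q / (2 * t)))

theorem gaussKernel_eq_exp (n : ℕ) {t : ℝ} (ht : 0 < t) (Q : ℝ) :
    gaussKernel n t Q
      = Real.exp (-(n / 2 * (Real.log (2 * Real.pi) + Real.log t)) - Q / (2 * t)) := by
  have hpi := Real.pi_pos
  have h : (√(2 * Real.pi * t))⁻¹ = Real.exp (-(Real.log (2 * Real.pi) + Real.log t) / 2) := by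
    rw [← Real.log_mul (by positivity) ht.ne', neg_div, Real.exp_neg, ← Real.log_sqrt (by positivity),
      Real.exp_log (by positivity)]
  rw [gaussKernel, h, ← Real.exp_nat_mul, ← Real.exp_add]
  congr 1
  ring

theorem gaussKernel_pos (n : ℕ) {t : ℝ} (ht : 0 < t) (Q : ℝ) : 0 < gaussKernel n t Q := by
  rw [gaussKernel_eq_exp n ht]; exact Real.exp_pos _

theorem gaussKernel_shift (n : ℕ) (t Q R : ℝ) :
    gaussKernel n t Q = gaussKernel n t R * Real.exp (-((Q - R) / (2 * t))) := by
  rw [gaussKernel, gaussKernel, mul_assoc (_ ^ n), ← Real.exp_add]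
  congr 2
  ring

/-- For a given residual sum of squares, the likelihood is largest at the empirical variance. -/
theorem gaussKernel_le_peak {n : ℕ} (hn : 0 < n) {t R : ℝ} (ht : 0 < t) (hR : 0 < R) :
    gaussKernel n t R ≤ gaussKernel n (R / n) R := by
  have hn' : (0:ℝ) < n := by exact_mod_cast hn
  rw [gaussKernel_eq_exp n ht, gaussKernel_eq_exp n (by positivity)]
  apply Real.exp_le_exp.2
  -- The whole maximization is `log x ≤ x - 1` at `x = (R / n) / t`.
  have h1 : Real.log (R / n / t) ≤ R / n / t - 1 := Real.log_le_sub_one_of_pos (by positivity)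
  rw [Real.log_div (by positivity) ht.ne'] at h1
  have h2 : R / (2 * (R / n)) = n / 2 := by field_simp
  have h3 : R / (2 * t) = n / 2 * (R / n / t) := by field_simp
  rw [h2, h3]
  nlinarith

/-- Raising the variance by a factor of at most `1 + 1 / n` costs `(n / 2) log (1 + 1 / n) ≤ 1 / 2`
in the normalization and gains in the exponent. The loss is a constant, while the window still has
width of order `1 / n`. -/
theorem peak_mul_exp_le_gaussKernel {n : ℕ} (hn : 0 < n) {t R : ℝ} (hR : 0 < R) (h1 : R / n ≤ t)
    (h2 : t ≤ R / n * (1 + 1 / n)) :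
    gaussKernel n (R / n) R * Real.exp (-(1 / 2)) ≤ gaussKernel n t R := by
  have hn' : (0:ℝ) < n := by exact_mod_cast hn
  have hs : 0 < R / n := by positivity
  have ht : 0 < t := hs.trans_le h1
  rw [gaussKernel_eq_exp n ht, gaussKernel_eq_exp n hs, ← Real.exp_add]
  apply Real.exp_le_exp.2
  have h3 : Real.log t ≤ Real.log (R / n) + 1 / n := by
    have h4 := Real.log_le_log ht h2
    rw [Real.log_mul hs.ne' (by positivity)] at h4
    have := Real.log_le_sub_one_of_pos (show (0:ℝ) < 1 + 1 / n by positivity)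
    linarith
  have h4 : R / (2 * t) ≤ R / (2 * (R / n)) := by gcongr
  have h5 : (n:ℝ) / 2 * Real.log t ≤ n / 2 * (Real.log (R / n)) + 1 / 2 := by
    have : (n:ℝ) / 2 * Real.log t ≤ n / 2 * (Real.log (R / n) + 1 / n) := by gcongr
    have h6 : (n:ℝ) / 2 * (1 / n) = 1 / 2 := by field_simp
    linarith
  linarith

/-- Here `t` is at least `16 / 5` times the peak location `R / n`. Dropping `Q` loses `n / 2`, and
the normalization wins `(n / 2) log (16 / 5) ≥ 11 n / 20`; the net gain `n / 20` is uniform in `Q`,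
hence in `β`. -/
theorem gaussKernel_le_of_large_variance {n : ℕ} (hn : 0 < n) {t R Q τ : ℝ} (hR : 0 < R)
    (hτ : R ≤ 5 / 4 * n * τ) (ht : 4 * τ ≤ t) (hQ : 0 ≤ Q) :
    gaussKernel n t Q ≤ gaussKernel n (R / n) R * Real.exp (-(n / 20)) := by
  have hn' : (0:ℝ) < n := by exact_mod_cast hn
  have hs : 0 < R / n := by positivity
  have hst : R / n * (16 / 5) ≤ t := by
    have : R / n ≤ 5 / 4 * τ := by rw [div_le_iff₀ hn']; linarith
    linarith
  have ht0 : 0 < t := by linarith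
  rw [gaussKernel_eq_exp n ht0, gaussKernel_eq_exp n hs, ← Real.exp_add]
  apply Real.exp_le_exp.2
  have h1 : (11 / 10 : ℝ) ≤ Real.log (16 / 5) := by
    rw [Real.le_log_iff_exp_le (by norm_num)]
    have h2 : Real.exp (11 / 10) = Real.exp 1 * Real.exp (1 / 10) := by
      rw [← Real.exp_add]; norm_num
    have h3 : Real.exp (1 / 10) ≤ 10 / 9 := by
      have := Real.one_sub_le_exp_neg (1 / 10)
      rw [Real.exp_neg] at this
      rw [← inv_inv (Real.exp (1 / 10))]
      refine inv_le_of_inv_le₀ (by norm_num) ?_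
      norm_num at this ⊢
      exact this
    rw [h2]
    have := Real.exp_one_lt_d9
    nlinarith [Real.exp_pos (1 / 10)]
  have h4 := Real.log_le_log (by positivity) hst
  rw [Real.log_mul hs.ne' (by norm_num)] at h4
  have h5 : R / (2 * (R / n)) = n / 2 := by field_simp
  have h6 : 0 ≤ Q / (2 * t) := by positivity
  rw [h5]
  nlinarith [mul_le_mul_of_nonneg_left (show Real.log (R / n) + 11 / 10 ≤ Real.log t by linarith)
    hn'.le]

/-! ### Bounds for the design -/

theorem dotProduct_self_nonneg' {m : ℕ} (v : Fin m → ℝ) : 0 ≤ v ⬝ᵥ v :=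
  Finset.sum_nonneg fun i _ => mul_self_nonneg (v i)

theorem abs_mulVec_dot_le {n p : ℕ} (X : Matrix (Fin n) (Fin p) ℝ) (v : Fin p → ℝ) (e : Fin n → ℝ)
    {B : ℝ} (hB : ∀ j, |Xᵀ j ⬝ᵥ e| ≤ B) : |(X *ᵥ v) ⬝ᵥ e| ≤ B * l1norm v := by
  have h : (X *ᵥ v) ⬝ᵥ e = ∑ j, v j * (Xᵀ j ⬝ᵥ e) := by
    rw [Matrix.mulVec_eq_sum, sum_dotProduct]
    exact Finset.sum_congr rfl fun j _ => by rw [op_smul_eq_smul, smul_dotProduct, smul_eq_mul]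
  rw [h, l1norm, Finset.mul_sum]
  refine (Finset.abs_sum_le_sum_abs _ _).trans (Finset.sum_le_sum fun j _ => ?_)
  rw [abs_mul, mul_comm]
  exact mul_le_mul_of_nonneg_right (hB j) (abs_nonneg _)

theorem mulVec_dot_self_le {n p : ℕ} {X : Matrix (Fin n) (Fin p) ℝ} (hX : ∀ i j, |X i j| ≤ 1)
    (v : Fin p → ℝ) : (X *ᵥ v) ⬝ᵥ (X *ᵥ v) ≤ n * l1norm v ^ 2 := by
  have h : ∀ i, (X *ᵥ v) i * (X *ᵥ v) i ≤ l1norm v ^ 2 := by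
    intro i
    rw [← sq, ← sq_abs]
    refine pow_le_pow_left₀ (abs_nonneg _) ?_ 2
    rw [Matrix.mulVec, dotProduct]
    refine (Finset.abs_sum_le_sum_abs _ _).trans (Finset.sum_le_sum fun j _ => ?_)
    rw [abs_mul]
    exact mul_le_of_le_one_left (abs_nonneg _) (hX i j)
  calc _ ≤ ∑ _i : Fin n, l1norm v ^ 2 := Finset.sum_le_sum fun i _ => h i
    _ = _ := by simp

/-- A lower bound on the eigenvalues of the Gram matrix of the columns in `ξ` bounds the quadratic
form from below on vectors supported in `ξ`. -/
theorem minEigenvalueGE_mulVec {n p : ℕ} (X : Matrix (Fin n) (Fin p) ℝ) (ξ : Finset (Fin p)) (c : ℝ)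
    (h : MinEigenvalueGE ((subDesign X ξ)ᵀ * subDesign X ξ) c) (v : Fin p → ℝ)
    (hv : ∀ j ∉ ξ, v j = 0) : c * (v ⬝ᵥ v) ≤ (X *ᵥ v) ⬝ᵥ (X *ᵥ v) := by
  set A := (subDesign X ξ)ᵀ * subDesign X ξ with hA
  have hAh : A.IsHermitian := Matrix.isHermitian_conjTranspose_mul_self (subDesign X ξ)
  have hBh : (A - c • (1 : Matrix ξ ξ ℝ)).IsHermitian := by
    refine hAh.sub ?_
    rw [Matrix.IsHermitian, Matrix.conjTranspose_smul]
    simp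
  -- Adding `c` to an eigenvalue of `A - c` gives an eigenvalue of `A`, so the spectral hypothesis
  -- is positive semidefiniteness of the shifted Gram matrix.
  have hpsd : (A - c • (1 : Matrix ξ ξ ℝ)).PosSemidef := by
    rw [hBh.posSemidef_iff_eigenvalues_nonneg]
    intro i
    have h1 := hBh.mulVec_eigenvectorBasis i
    set w := (hBh.eigenvectorBasis i).ofLp with hw
    have hw0 : w ≠ 0 := by
      intro h0
      apply hBh.eigenvectorBasis.toBasis.ne_zero i
      ext k
      have := congrFun h0 k
      simpa [hw] using this
    have h2 : A *ᵥ w = (hBh.eigenvalues i + c) • w := by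
      rw [Matrix.sub_mulVec, Matrix.smul_mulVec, Matrix.one_mulVec, sub_eq_iff_eq_add] at h1
      rw [h1, add_smul]
    have h3 := h _ (Module.End.hasEigenvalue_of_hasEigenvector
      (f := Matrix.toLin' A) (x := w) ⟨Module.End.mem_eigenspace_iff.2 (by simpa using h2), hw0⟩)
    simp only [Pi.zero_apply]
    linarith
  have h4 := hpsd.dotProduct_mulVec_nonneg (fun j : ξ => v j)
  have h5 : subDesign X ξ *ᵥ (fun j : ξ => v j) = X *ᵥ v := by
    ext i
    simp only [Matrix.mulVec, dotProduct, subDesign, Matrix.submatrix_apply, id]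
    rw [← Finset.sum_subset (Finset.subset_univ ξ) fun j _ hj => by rw [hv j hj, mul_zero]]
    exact Finset.sum_coe_sort ξ fun j => X i j * v j
  have h6 : (fun j : ξ => v j) ⬝ᵥ (fun j : ξ => v j) = v ⬝ᵥ v := by
    simp only [dotProduct]
    rw [← Finset.sum_subset (Finset.subset_univ ξ) fun j _ hj => by rw [hv j hj, mul_zero]]
    exact Finset.sum_coe_sort ξ fun j => v j * v j
  rw [Matrix.sub_mulVec, Matrix.smul_mulVec, Matrix.one_mulVec, dotProduct_sub, dotProduct_smul,
    star_trivial, h6, hA, ← Matrix.mulVec_mulVec, Matrix.dotProduct_mulVec, Matrix.vecMul_transpose,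
    h5, smul_eq_mul] at h4
  linarith

/-! ### Residual sums of squares -/

theorem residual_eq {n p : ℕ} (X : Matrix (Fin n) (Fin p) ℝ) (βs β : Fin p → ℝ) (σ : ℝ)
    (e : Fin n → ℝ) :
    l2norm (X *ᵥ βs + σ • e - X *ᵥ β) ^ 2 = σ ^ 2 * (e ⬝ᵥ e)
      - 2 * σ * ((X *ᵥ (β - βs)) ⬝ᵥ e) + (X *ᵥ (β - βs)) ⬝ᵥ (X *ᵥ (β - βs)) := by
  have h : X *ᵥ βs + σ • e - X *ᵥ β = σ • e - X *ᵥ (β - βs) := by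
    rw [Matrix.mulVec_sub]; abel
  rw [l2norm_sq, h, sub_dotProduct, dotProduct_sub, dotProduct_sub, smul_dotProduct,
    dotProduct_smul, smul_dotProduct, dotProduct_smul, dotProduct_comm e (X *ᵥ (β - βs))]
  simp only [smul_eq_mul]
  ring

/-- Near the true coefficients the residual sum of squares exceeds that of the truth by little. -/
theorem residual_sub_le {n p : ℕ} {X : Matrix (Fin n) (Fin p) ℝ} (hX : ∀ i j, |X i j| ≤ 1)
    {βs β : Fin p → ℝ} {σ ℓ κ r t : ℝ} {e : Fin n → ℝ} (hσ : 0 < σ) (hℓ : 0 ≤ ℓ)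
    (hr : √n * (p * r) ≤ κ * √ℓ) (ht : 0 < t) (htσ : σ ≤ 2 * √t)
    (he : ∀ j, |Xᵀ j ⬝ᵥ e| ≤ 2 * √n * √ℓ) (hβ : ∀ j, |β j - βs j| ≤ r * √t) :
    (l2norm (X *ᵥ βs + σ • e - X *ᵥ β) ^ 2 - σ ^ 2 * (e ⬝ᵥ e)) / (2 * t)
      ≤ (4 * κ + κ ^ 2) * ℓ := by
  have hst : 0 < √t := Real.sqrt_pos.2 ht
  have hl1 : l1norm (β - βs) ≤ p * r * √t := by
    refine (Finset.sum_le_sum fun j _ => hβ j).trans (le_of_eq ?_)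
    simp; ring
  have hl0 : 0 ≤ l1norm (β - βs) := Finset.sum_nonneg fun j _ => abs_nonneg _
  have h1 := abs_mulVec_dot_le X (β - βs) e he
  have h2 := mulVec_dot_self_le hX (β - βs)
  have hn : √(n:ℝ) ^ 2 = n := Real.sq_sqrt (Nat.cast_nonneg n)
  have hl : √ℓ ^ 2 = ℓ := Real.sq_sqrt hℓ
  have ht2 : √t ^ 2 = t := Real.sq_sqrt ht.le
  have h3 : √n * l1norm (β - βs) ≤ κ * √ℓ * √t := by
    calc √n * l1norm (β - βs) ≤ √n * (p * r * √t) := by gcongr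
      _ = √n * (p * r) * √t := by ring
      _ ≤ _ := by gcongr
  have h3' : 0 ≤ √n * l1norm (β - βs) := by positivity
  have h4 : |(X *ᵥ (β - βs)) ⬝ᵥ e| ≤ 2 * κ * ℓ * √t := by
    calc _ ≤ 2 * √ℓ * (√n * l1norm (β - βs)) := by linarith
      _ ≤ 2 * √ℓ * (κ * √ℓ * √t) := by gcongr
      _ = 2 * κ * √ℓ ^ 2 * √t := by ring
      _ = _ := by rw [hl]
  have h5 : (X *ᵥ (β - βs)) ⬝ᵥ (X *ᵥ (β - βs)) ≤ κ ^ 2 * ℓ * t := by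
    calc _ ≤ (√n * l1norm (β - βs)) ^ 2 := by rw [mul_pow, hn]; exact h2
      _ ≤ (κ * √ℓ * √t) ^ 2 := by gcongr
      _ = _ := by rw [mul_pow, mul_pow, hl, ht2]
  rw [div_le_iff₀ (by positivity), residual_eq]
  have h6 : -(2 * σ * ((X *ᵥ (β - βs)) ⬝ᵥ e)) ≤ 2 * (2 * √t) * (2 * κ * ℓ * √t) := by
    calc _ ≤ 2 * σ * |(X *ᵥ (β - βs)) ⬝ᵥ e| := by
          have := neg_abs_le ((X *ᵥ (β - βs)) ⬝ᵥ e); nlinarith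
      _ ≤ _ := by gcongr
  have h7 : 2 * (2 * √t) * (2 * κ * ℓ * √t) = 8 * κ * ℓ * t := by
    linear_combination (8 * κ * ℓ) * ht2
  have h8 := dotProduct_self_nonneg' (X *ᵥ (β - βs))
  nlinarith

/-- If the error of the coefficients has a large sparse part, and a small remainder, then the
residual sum of squares is large. -/
theorem le_residual_sub {n p : ℕ} {X : Matrix (Fin n) (Fin p) ℝ} (hX : ∀ i j, |X i j| ≤ 1)
    {βs β v z : Fin p → ℝ} {σ ℓ κ C₀ A : ℝ} {e : Fin n → ℝ} (hσ : 0 < σ) (hℓ : 0 ≤ ℓ)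
    (he : ∀ j, |Xᵀ j ⬝ᵥ e| ≤ 2 * √n * √ℓ) (hsum : β - βs = v + z)
    (hz : √n * l1norm z ≤ 2 * κ * √ℓ * σ) (hAC : 64 * C₀ ≤ A ^ 2)
    (hv : ((X *ᵥ v) ⬝ᵥ e) ^ 2 ≤ C₀ * ℓ * ((X *ᵥ v) ⬝ᵥ (X *ᵥ v)))
    (hvA : A ^ 2 * (ℓ * σ ^ 2) ≤ (X *ᵥ v) ⬝ᵥ (X *ᵥ v)) :
    (A ^ 2 / 4 - 8 * κ - 4 * κ ^ 2) * (ℓ * σ ^ 2) ≤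
      l2norm (X *ᵥ βs + σ • e - X *ᵥ β) ^ 2 - σ ^ 2 * (e ⬝ᵥ e) := by
  rw [residual_eq, hsum, Matrix.mulVec_add, add_dotProduct]
  set w := X *ᵥ v with hw
  set y := X *ᵥ z with hy
  have hn : √(n:ℝ) ^ 2 = n := Real.sq_sqrt (Nat.cast_nonneg n)
  have hl : √ℓ ^ 2 = ℓ := Real.sq_sqrt hℓ
  have hl0 : 0 ≤ l1norm z := Finset.sum_nonneg fun j _ => abs_nonneg _
  have h1 : |y ⬝ᵥ e| ≤ 4 * κ * ℓ * σ := by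
    calc _ ≤ 2 * √ℓ * (√n * l1norm z) := by
          have := abs_mulVec_dot_le X z e he; linarith
      _ ≤ 2 * √ℓ * (2 * κ * √ℓ * σ) := by gcongr
      _ = 4 * κ * √ℓ ^ 2 * σ := by ring
      _ = _ := by rw [hl]
  have h2 : y ⬝ᵥ y ≤ 4 * κ ^ 2 * ℓ * σ ^ 2 := by
    calc _ ≤ (√n * l1norm z) ^ 2 := by rw [mul_pow, hn]; exact mulVec_dot_self_le hX z
      _ ≤ (2 * κ * √ℓ * σ) ^ 2 := by gcongr
      _ = 4 * κ ^ 2 * √ℓ ^ 2 * σ ^ 2 := by ring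
      _ = _ := by rw [hl]
  -- This is half of `0 ≤ ‖w + 2y‖²`.
  have h3 : w ⬝ᵥ w / 2 - y ⬝ᵥ y ≤ (w + y) ⬝ᵥ (w + y) := by
    have := dotProduct_self_nonneg' (w + (2:ℝ) • y)
    simp only [add_dotProduct, dotProduct_add, smul_dotProduct, dotProduct_smul, smul_eq_mul,
      dotProduct_comm y w] at this ⊢
    nlinarith
  have hww := dotProduct_self_nonneg' w
  -- The noise term is of order `√ℓ ‖w‖` and `‖w‖ ≥ A √ℓ σ`; with `64 C₀ ≤ A²` it uses only half of
  -- the `‖w‖² / 2` kept in `h3`.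
  have h4 : 2 * σ * (w ⬝ᵥ e) ≤ w ⬝ᵥ w / 4 := by
    have h5 : (2 * σ * (w ⬝ᵥ e)) ^ 2 ≤ (w ⬝ᵥ w / 4) ^ 2 := by
      calc _ = 4 * σ ^ 2 * (w ⬝ᵥ e) ^ 2 := by ring
        _ ≤ 4 * σ ^ 2 * (C₀ * ℓ * (w ⬝ᵥ w)) := by gcongr
        _ = (64 * C₀) * (ℓ * σ ^ 2) * (w ⬝ᵥ w) / 16 := by ring
        _ ≤ A ^ 2 * (ℓ * σ ^ 2) * (w ⬝ᵥ w) / 16 := by gcongr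
        _ ≤ (w ⬝ᵥ w) * (w ⬝ᵥ w) / 16 := by gcongr
        _ = _ := by ring
    exact le_of_sq_le_sq h5 (by positivity)
  have h6 : 2 * σ * (y ⬝ᵥ e) ≤ 2 * σ * (4 * κ * ℓ * σ) := by
    have := le_abs_self (y ⬝ᵥ e)
    gcongr
    linarith
  nlinarith

/-! ### The posterior for good noise -/

theorem l1norm_nonneg {m : ℕ} (v : Fin m → ℝ) : 0 ≤ l1norm v :=
  Finset.sum_nonneg fun _ _ => abs_nonneg _

theorem l2norm_nonneg {m : ℕ} (v : Fin m → ℝ) : 0 ≤ l2norm v := Real.sqrt_nonneg _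

theorem l2norm_le_l1norm {m : ℕ} (v : Fin m → ℝ) : l2norm v ≤ l1norm v := by
  refine Real.sqrt_le_iff.2 ⟨l1norm_nonneg v, ?_⟩
  have := Finset.sum_sq_le_sq_sum_of_nonneg (s := Finset.univ) (f := fun j => |v j|)
    fun j _ => abs_nonneg _
  simpa [l1norm] using this

theorem l2norm_add_le {m : ℕ} (v w : Fin m → ℝ) : l2norm (v + w) ≤ l2norm v + l2norm w := by
  have h : ∀ u : Fin m → ℝ, l2norm u = ‖WithLp.toLp 2 u‖ := by
    intro u; simp [l2norm, EuclideanSpace.norm_eq]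
  rw [h, h, h, WithLp.toLp_add]
  exact norm_add_le _ _

theorem l1norm_add_le {m : ℕ} (v w : Fin m → ℝ) : l1norm (v + w) ≤ l1norm v + l1norm w := by
  rw [l1norm, l1norm, l1norm, ← Finset.sum_add_distrib]
  exact Finset.sum_le_sum fun j _ => abs_add_le _ _

theorem l1norm_le_sqrt_mul_l2norm {m : ℕ} (v : Fin m → ℝ) (T : Finset (Fin m))
    (hv : ∀ j ∉ T, v j = 0) : l1norm v ≤ √T.card * l2norm v := by
  rw [l2norm, ← Real.sqrt_mul (Nat.cast_nonneg _)]
  apply Real.le_sqrt_of_sq_le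
  have h1 : l1norm v = ∑ j ∈ T, |v j| :=
    (Finset.sum_subset (Finset.subset_univ T) fun j _ hj => by rw [hv j hj, abs_zero]).symm
  have h2 : ∑ j, v j ^ 2 = ∑ j ∈ T, |v j| ^ 2 := by
    simp_rw [sq_abs]
    exact (Finset.sum_subset (Finset.subset_univ T) fun j _ hj => by rw [hv j hj]; simp).symm
  rw [h1, h2]
  exact sq_sum_le_card_mul_sum_sq

/-- A coefficient vector with fewer than `k` entries exceeding `r √t` differs from an `s`-sparse
vector by a `(k + s)`-sparse vector and a small remainder. -/
theorem exists_sparse_add_small {p k s : ℕ} (βs β : Fin p → ℝ) {r t : ℝ} (hr : 0 ≤ r) (ht : 0 < t)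
    (hs : (Finset.univ.filter fun j => βs j ≠ 0).card = s)
    (hk : (Finset.univ.filter fun j => r < |β j / √t|).card < k) :
    ∃ (T : Finset (Fin p)) (v z : Fin p → ℝ), T.card ≤ k + s ∧ (∀ j ∉ T, v j = 0) ∧
      β - βs = v + z ∧ l1norm z ≤ p * r * √t := by
  have hst : 0 < √t := Real.sqrt_pos.2 ht
  -- Off `T` the true coefficient is zero, so the error there is `β j` itself, at most `r √t` in
  -- size.
  set T := (Finset.univ.filter fun j => r < |β j / √t|) ∪ Finset.univ.filter fun j => βs j ≠ 0
    with hT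
  refine ⟨T, fun j => if j ∈ T then β j - βs j else 0, fun j => if j ∈ T then 0 else β j - βs j,
    ?_, ?_, ?_, ?_⟩
  · exact (Finset.card_union_le _ _).trans (by omega)
  · intro j hj; simp [hj]
  · ext j; by_cases hj : j ∈ T <;> simp [hj]
  · refine le_trans (Finset.sum_le_sum (g := fun _ => r * √t) fun j _ => ?_) (le_of_eq ?_)
    · by_cases hj : j ∈ T
      · simp only [hj, if_true, abs_zero]; positivity
      · simp only [hj, if_false]
        simp only [hT, Finset.mem_union, Finset.mem_filter, Finset.mem_univ, true_and, not_or,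
          not_lt, not_not] at hj
        rw [hj.2, sub_zero]
        have := hj.1
        rwa [abs_div, abs_of_pos hst, div_le_iff₀ hst] at this
    · simp; ring

theorem likelihood_eq_gaussKernel {n p : ℕ} (X : Matrix (Fin n) (Fin p) ℝ) (y : Fin n → ℝ)
    (θ : (Fin p → ℝ) × ℝ) :
    likelihood X y θ = ENNReal.ofReal (gaussKernel n θ.2 (l2norm (y - X *ᵥ θ.1) ^ 2)) := rfl

section GoodNoise

variable {n p : ℕ} {X : Matrix (Fin n) (Fin p) ℝ} {βs : Fin p → ℝ} {σ ℓ κ r : ℝ} {e : Fin n → ℝ}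

/-- The likelihood near the true coefficients. -/
theorem le_likelihood_of_close (hn : 0 < n) (hX : ∀ i j, |X i j| ≤ 1) (hσ : 0 < σ) (hℓ : 0 ≤ ℓ)
    (hr : √n * (p * r) ≤ κ * √ℓ) (he1 : |e ⬝ᵥ e - n| ≤ 1 / 4 * n)
    (he2 : ∀ j, |Xᵀ j ⬝ᵥ e| ≤ 2 * √n * √ℓ) {θ : (Fin p → ℝ) × ℝ}
    (hθ1 : σ ^ 2 * (e ⬝ᵥ e) / n ≤ θ.2) (hθ2 : θ.2 ≤ σ ^ 2 * (e ⬝ᵥ e) / n * (1 + 1 / n))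
    (hθ3 : ∀ j, |θ.1 j / √θ.2 - βs j / √θ.2| ≤ r) :
    ENNReal.ofReal (gaussKernel n (σ ^ 2 * (e ⬝ᵥ e) / n) (σ ^ 2 * (e ⬝ᵥ e)) *
      Real.exp (-(1 / 2 + (4 * κ + κ ^ 2) * ℓ))) ≤ likelihood X (X *ᵥ βs + σ • e) θ := by
  obtain ⟨β, t⟩ := θ
  simp only at hθ1 hθ2 hθ3
  have hn' : (0:ℝ) < n := by exact_mod_cast hn
  have he := abs_le.1 he1
  have hee : 3 / 4 * n ≤ e ⬝ᵥ e := by linarith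
  have hR : 0 < σ ^ 2 * (e ⬝ᵥ e) := by
    have : 0 < e ⬝ᵥ e := by linarith
    positivity
  have ht34 : 3 / 4 * σ ^ 2 ≤ t := by
    refine le_trans ?_ hθ1
    rw [le_div_iff₀ hn']
    nlinarith [mul_le_mul_of_nonneg_left hee (sq_nonneg σ)]
  have ht : 0 < t := lt_of_lt_of_le (by positivity) ht34
  have hst : 0 < √t := Real.sqrt_pos.2 ht
  have hσt : σ ≤ 2 * √t := by
    refine le_of_sq_le_sq ?_ (by positivity)
    rw [mul_pow, Real.sq_sqrt ht.le]
    linarith [sq_nonneg σ]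
  have hβ : ∀ j, |β j - βs j| ≤ r * √t := by
    intro j
    have := hθ3 j
    rwa [← sub_div, abs_div, abs_of_pos hst, div_le_iff₀ hst] at this
  have h1 := residual_sub_le hX hσ hℓ hr ht hσt he2 hβ
  rw [likelihood_eq_gaussKernel]
  apply ENNReal.ofReal_le_ofReal
  simp only
  rw [gaussKernel_shift n t _ (σ ^ 2 * (e ⬝ᵥ e)), neg_add, Real.exp_add, ← mul_assoc]
  refine mul_le_mul (peak_mul_exp_le_gaussKernel hn hR hθ1 hθ2) (Real.exp_le_exp.2 ?_)
    (Real.exp_pos _).le (gaussKernel_pos n ht _).le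
  linarith

/-- Away from the true coefficients the likelihood of sparse coefficients is small. -/
theorem likelihood_le_of_far {k s : ℕ} {lam C₀ C₃ H A : ℝ}
    (hn : 0 < n) (hX : ∀ i j, |X i j| ≤ 1) (hσ : 0 < σ) (hℓ : 0 ≤ ℓ) (hr0 : 0 ≤ r)
    (hκ : 0 ≤ κ) (hr : √n * (p * r) ≤ κ * √ℓ) (he1 : |e ⬝ᵥ e - n| ≤ 1 / 4 * n)
    (he2 : ∀ j, |Xᵀ j ⬝ᵥ e| ≤ 2 * √n * √ℓ)
    (he3 : ∀ (T : Finset (Fin p)) (v : Fin p → ℝ), T.card ≤ k + s → (∀ j ∉ T, v j = 0) →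
      ((X *ᵥ v) ⬝ᵥ e) ^ 2 ≤ C₀ * ℓ * ((X *ᵥ v) ⬝ᵥ (X *ᵥ v)))
    (hlam0 : 0 ≤ lam)
    (hlam : ∀ (T : Finset (Fin p)) (v : Fin p → ℝ), T.card ≤ k + s → (∀ j ∉ T, v j = 0) →
      n * lam * (v ⬝ᵥ v) ≤ (X *ᵥ v) ⬝ᵥ (X *ᵥ v))
    (hs : (Finset.univ.filter fun j => βs j ≠ 0).card = s) (hs1 : 1 ≤ s)
    (hH : 2 * κ ≤ H) (hAH : A ^ 2 * (k + s) ≤ lam * (H - 2 * κ) ^ 2 * s)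
    (hAC : 64 * C₀ ≤ A ^ 2) (hAC3 : 8 * C₃ ≤ A ^ 2 / 4 - 8 * κ - 4 * κ ^ 2)
    {θ : (Fin p → ℝ) × ℝ} (hθ2 : 0 < θ.2) (hθσ : θ.2 ≤ 4 * σ ^ 2)
    (hθk : (Finset.univ.filter fun j => r < |θ.1 j / √θ.2|).card < k)
    (hθ : H * σ * √(ℓ / n) ≤ l2norm (θ.1 - βs) ∨
      H * σ * √s * √(ℓ / n) ≤ l1norm (θ.1 - βs)) (hC₃ : 0 ≤ C₃) :
    likelihood X (X *ᵥ βs + σ • e) θ ≤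
      ENNReal.ofReal (gaussKernel n (σ ^ 2 * (e ⬝ᵥ e) / n) (σ ^ 2 * (e ⬝ᵥ e)) *
        Real.exp (-(C₃ * ℓ))) := by
  obtain ⟨β, t⟩ := θ
  simp only at hθ2 hθσ hθk hθ
  have hn' : (0:ℝ) < n := by exact_mod_cast hn
  have hs' : (1:ℝ) ≤ s := by exact_mod_cast hs1
  have hee : 0 < e ⬝ᵥ e := by linarith [(abs_le.1 he1).1]
  have hR : 0 < σ ^ 2 * (e ⬝ᵥ e) := by positivity
  have hst : √t ≤ 2 * σ := by
    refine Real.sqrt_le_iff.2 ⟨by positivity, ?_⟩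
    linarith
  obtain ⟨T, v, z, hT, hv, hsum, hz⟩ := exists_sparse_add_small βs β hr0 hθ2 hs hθk
  have hsn : 0 < √(n:ℝ) := Real.sqrt_pos.2 hn'
  have hz2 : √n * l1norm z ≤ 2 * κ * √ℓ * σ := by
    calc √n * l1norm z ≤ √n * (p * r * (2 * σ)) := by
          have : (p:ℝ) * r * √t ≤ p * r * (2 * σ) := by gcongr
          gcongr; linarith
      _ = √n * (p * r) * (2 * σ) := by ring
      _ ≤ κ * √ℓ * (2 * σ) := by gcongr
      _ = _ := by ring
  have hz3 : l1norm z ≤ 2 * κ * σ * √(ℓ / n) := by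
    rw [Real.sqrt_div hℓ, ← mul_div_assoc, le_div_iff₀ hsn]
    linarith
  have hss : 1 ≤ √(s:ℝ) := Real.one_le_sqrt.2 hs'
  have hT' : √(T.card : ℝ) ≤ √((k:ℝ) + s) := Real.sqrt_le_sqrt (by exact_mod_cast hT)
  have hsk : √(s:ℝ) ≤ √((k:ℝ) + s) := Real.sqrt_le_sqrt (by simp)
  have hl2 := l2norm_nonneg v
  have hsl : 0 ≤ √(ℓ / n) := Real.sqrt_nonneg _
  -- Both kinds of separation lead to this one bound: the `L₂` case is multiplied by `√s ≤ √(k +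
  -- s)`, the `L₁` case uses Cauchy–Schwarz on the support of `v`.
  have hlarge : (H - 2 * κ) * σ * √s * √(ℓ / n) ≤ √((k:ℝ) + s) * l2norm v := by
    rcases hθ with h | h
    · rw [hsum] at h
      have h1 := (h.trans (l2norm_add_le v z)).trans
        (add_le_add_right (l2norm_le_l1norm z) _)
      have h2 : (H - 2 * κ) * σ * √(ℓ / n) ≤ l2norm v := by linarith
      calc (H - 2 * κ) * σ * √s * √(ℓ / n) = √s * ((H - 2 * κ) * σ * √(ℓ / n)) := by ring
        _ ≤ √((k:ℝ) + s) * l2norm v := by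
          have : 0 ≤ H - 2 * κ := by linarith
          gcongr
    · rw [hsum] at h
      have h1 := (h.trans (l1norm_add_le v z)).trans
        (add_le_add_left (l1norm_le_sqrt_mul_l2norm v T hv) _)
      have h2 : √(T.card : ℝ) * l2norm v ≤ √((k:ℝ) + s) * l2norm v := by gcongr
      have h3 : 2 * κ * σ * √(ℓ / n) ≤ 2 * κ * σ * √(ℓ / n) * √s :=
        le_mul_of_one_le_right (by positivity) hss
      linarith
  have hvv : (H - 2 * κ) ^ 2 * σ ^ 2 * s * (ℓ / n) ≤ (k + s) * (v ⬝ᵥ v) := by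
    have h0 : 0 ≤ (H - 2 * κ) * σ * √s * √(ℓ / n) := by
      have : 0 ≤ H - 2 * κ := by linarith
      positivity
    have := pow_le_pow_left₀ h0 hlarge 2
    rwa [mul_pow, mul_pow, mul_pow, mul_pow, Real.sq_sqrt (by positivity),
      Real.sq_sqrt (by positivity), Real.sq_sqrt (by positivity), l2norm_sq] at this
  have hvA : A ^ 2 * (ℓ * σ ^ 2) ≤ (X *ᵥ v) ⬝ᵥ (X *ᵥ v) := by
    refine le_trans ?_ (hlam T v hT hv)
    have hks : (0:ℝ) < k + s := by positivity
    refine le_of_mul_le_mul_left ?_ hks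
    calc (k + s : ℝ) * (A ^ 2 * (ℓ * σ ^ 2)) = A ^ 2 * (k + s) * (ℓ * σ ^ 2) := by ring
      _ ≤ lam * (H - 2 * κ) ^ 2 * s * (ℓ * σ ^ 2) := by gcongr
      _ = n * lam * ((H - 2 * κ) ^ 2 * σ ^ 2 * s * (ℓ / n)) := by field_simp
      _ ≤ n * lam * ((k + s) * (v ⬝ᵥ v)) := by gcongr
      _ = _ := by ring
  have hres := le_residual_sub hX hσ hℓ he2 hsum hz2 hAC (he3 T v hT hv) hvA
  rw [likelihood_eq_gaussKernel]
  apply ENNReal.ofReal_le_ofReal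
  simp only
  rw [gaussKernel_shift n t _ (σ ^ 2 * (e ⬝ᵥ e))]
  refine mul_le_mul (gaussKernel_le_peak hn hθ2 hR) (Real.exp_le_exp.2 (neg_le_neg ?_))
    (Real.exp_pos _).le (gaussKernel_pos n (by positivity) _).le
  -- The exponent is divided by `2t ≤ 8 σ²`, which is the source of the 8 in `8 * C₃`.
  rw [le_div_iff₀ (by positivity)]
  calc C₃ * ℓ * (2 * t) ≤ C₃ * ℓ * (2 * (4 * σ ^ 2)) := by gcongr
    _ = 8 * C₃ * (ℓ * σ ^ 2) := by ring
    _ ≤ (A ^ 2 / 4 - 8 * κ - 4 * κ ^ 2) * (ℓ * σ ^ 2) := by gcongr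
    _ ≤ _ := hres

end GoodNoise

/-- A set of parameters on which the likelihood is small carries little unnormalized mass. -/
theorem withDensity_le_of_le {α : Type*} [MeasurableSpace α] (μ : Measure α) {f : α → ℝ≥0∞}
    (hf : Measurable f) (c : ℝ≥0∞) : μ.withDensity f {x | f x ≤ c} ≤ c * μ Set.univ := by
  have hS : MeasurableSet {x | f x ≤ c} := measurableSet_le hf measurable_const
  rw [withDensity_apply _ hS]
  have h : ∫⁻ x in {x | f x ≤ c}, f x ∂μ ≤ ∫⁻ _x in {x | f x ≤ c}, c ∂μ :=
    setLIntegral_mono measurable_const fun x hx => hx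
  refine h.trans ?_
  rw [setLIntegral_const]
  gcongr
  exact Set.subset_univ _

theorem measurableSet_many_large (p : ℕ) (r : ℝ) (k : ℕ) : MeasurableSet
    {θ : (Fin p → ℝ) × ℝ | k ≤ (Finset.univ.filter fun j => r < |θ.1 j / √θ.2|).card} := by
  refine measurableSet_le measurable_const ?_
  simp_rw [Finset.card_filter]
  refine Finset.measurable_sum _ fun j _ => Measurable.ite ?_ measurable_const measurable_const
  exact measurableSet_lt measurable_const (by fun_prop)

/-- For good noise, the posterior probability of a set of parameters far from the truth is
small. -/
theorem posterior_le_of_good {n p : ℕ} {X : Matrix (Fin n) (Fin p) ℝ} {βs : Fin p → ℝ}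
    {σ ℓ κ r : ℝ} {e : Fin n → ℝ} {k s : ℕ} {lam C₀ C₃ H A a0 b0 : ℝ} {g : ℝ → ℝ}
    (ha0 : 0 < a0) (hb0 : 0 < b0) (hg : Measurable g) (hg0 : ∀ x, 0 ≤ g x) (hg1 : ∫ x, g x = 1)
    (hn : 0 < n) (hX : ∀ i j, |X i j| ≤ 1) (hσ : 0 < σ) (hℓ : 0 ≤ ℓ) (hr0 : 0 ≤ r)
    (hκ : 0 ≤ κ) (hr : √n * (p * r) ≤ κ * √ℓ) (he1 : |e ⬝ᵥ e - n| ≤ 1 / 4 * n)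
    (he2 : ∀ j, |Xᵀ j ⬝ᵥ e| ≤ 2 * √n * √ℓ)
    (he3 : ∀ (T : Finset (Fin p)) (v : Fin p → ℝ), T.card ≤ k + s → (∀ j ∉ T, v j = 0) →
      ((X *ᵥ v) ⬝ᵥ e) ^ 2 ≤ C₀ * ℓ * ((X *ᵥ v) ⬝ᵥ (X *ᵥ v)))
    (hlam0 : 0 ≤ lam)
    (hlam : ∀ (T : Finset (Fin p)) (v : Fin p → ℝ), T.card ≤ k + s → (∀ j ∉ T, v j = 0) →
      n * lam * (v ⬝ᵥ v) ≤ (X *ᵥ v) ⬝ᵥ (X *ᵥ v))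
    (hs : (Finset.univ.filter fun j => βs j ≠ 0).card = s) (hs1 : 1 ≤ s)
    (hH : 2 * κ ≤ H) (hAH : A ^ 2 * (k + s) ≤ lam * (H - 2 * κ) ^ 2 * s)
    (hAC : 64 * C₀ ≤ A ^ 2) (hAC3 : 8 * C₃ ≤ A ^ 2 / 4 - 8 * κ - 4 * κ ^ 2) (hC₃ : 0 ≤ C₃)
    (F : Set ((Fin p → ℝ) × ℝ))
    (hF : ∀ θ ∈ F, H * σ * √(ℓ / n) ≤ l2norm (θ.1 - βs) ∨
      H * σ * √s * √(ℓ / n) ≤ l1norm (θ.1 - βs))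
    {q d : ℝ≥0∞}
    (hq : (∫⁻ θ in {θ | k ≤ (Finset.univ.filter fun j => r < |θ.1 j / √θ.2|).card},
        likelihood X (X *ᵥ βs + σ • e) θ ∂(prior p a0 b0 g)) *
      ENNReal.ofReal (√(2 * Real.pi * σ ^ 2) ^ n * Real.exp ((e ⬝ᵥ e) / 2)) ≤ q)
    (hd : d ≤ prior p a0 b0 g {θ | θ.2 ∈ Set.Icc (σ ^ 2 * (e ⬝ᵥ e) / n)
        (σ ^ 2 * (e ⬝ᵥ e) / n * (1 + 1 / n)) ∧ ∀ j, θ.1 j / √θ.2 ∈ {z | |z - βs j / √θ.2| ≤ r}}) :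
    posterior X a0 b0 g (X *ᵥ βs + σ • e) F ≤
      ((ENNReal.ofReal (Real.exp (-(n / 20))) + ENNReal.ofReal (Real.exp (-(C₃ * ℓ)))) *
        (∫⁻ t, ENNReal.ofReal (invGammaPDF a0 b0 t)) + q) /
      (ENNReal.ofReal (Real.exp (-(1 / 2 + (4 * κ + κ ^ 2) * ℓ))) * d) := by
  have hn' : (0:ℝ) < n := by exact_mod_cast hn
  set y := X *ᵥ βs + σ • e with hy
  have hee : 0 < e ⬝ᵥ e := by linarith [(abs_le.1 he1).1]
  set R := σ ^ 2 * (e ⬝ᵥ e) with hRdef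
  have hR : 0 < R := by positivity
  set pk := gaussKernel n (R / n) R with hpk
  have hpk0 : 0 < pk := gaussKernel_pos n (by positivity) _
  set Z := ∫⁻ t, ENNReal.ofReal (invGammaPDF a0 b0 t) with hZ
  have huniv : prior p a0 b0 g Set.univ = Z := prior_univ_le ha0 hb0 hg hg0 hg1
  have hlik : Measurable fun θ => likelihood X y θ :=
    (measurable_likelihood X).comp (measurable_const.prodMk measurable_id)
  set ν := (prior p a0 b0 g).withDensity (likelihood X y) with hν
  set B := {θ : (Fin p → ℝ) × ℝ |
    k ≤ (Finset.univ.filter fun j => r < |θ.1 j / √θ.2|).card} with hB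
  have hcover : F ⊆ ({θ | likelihood X y θ ≤ ENNReal.ofReal (pk * Real.exp (-(n / 20)))} ∪
      {θ | likelihood X y θ ≤ ENNReal.ofReal (pk * Real.exp (-(C₃ * ℓ)))}) ∪ B := by
    intro θ hθ
    by_cases hk : θ ∈ B
    · exact Or.inr hk
    left
    rcases le_or_gt θ.2 0 with h0 | h0
    · left
      -- For nonpositive variance the conventions `√x = 0` and `0⁻¹ = 0` make the likelihood zero,
      -- as `n > 0`.
      have : √(2 * Real.pi * θ.2) = 0 :=
        Real.sqrt_eq_zero_of_nonpos (mul_nonpos_of_nonneg_of_nonpos (by positivity) h0)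
      simp [likelihood, this, hn.ne']
    rcases le_or_gt θ.2 (4 * σ ^ 2) with h4 | h4
    · right
      exact likelihood_le_of_far hn hX hσ hℓ hr0 hκ hr he1 he2 he3 hlam0 hlam hs hs1 hH hAH hAC
        hAC3 h0 h4 (not_le.1 hk) (hF θ hθ) hC₃
    · left
      refine ENNReal.ofReal_le_ofReal
        (gaussKernel_le_of_large_variance hn hR (τ := σ ^ 2) ?_ h4.le (sq_nonneg _))
      have := (abs_le.1 he1).2
      have h5 : e ⬝ᵥ e ≤ 5 / 4 * n := by linarith
      nlinarith [mul_le_mul_of_nonneg_left h5 (sq_nonneg σ)]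
  have hnum : ν F ≤ ENNReal.ofReal pk *
      ((ENNReal.ofReal (Real.exp (-(n / 20))) + ENNReal.ofReal (Real.exp (-(C₃ * ℓ)))) * Z + q) := by
    refine (measure_mono hcover).trans ((measure_union_le _ _).trans ?_)
    have h1 := withDensity_le_of_le (prior p a0 b0 g) hlik
      (ENNReal.ofReal (pk * Real.exp (-(n / 20))))
    have h2 := withDensity_le_of_le (prior p a0 b0 g) hlik
      (ENNReal.ofReal (pk * Real.exp (-(C₃ * ℓ))))
    rw [huniv, ENNReal.ofReal_mul hpk0.le] at h1 h2
    have h3 : ν B ≤ ENNReal.ofReal pk * q := by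
      rw [hν, withDensity_apply _ (measurableSet_many_large p r k)]
      -- The weight inverts the likelihood at the true parameters, and that likelihood is at most
      -- the peak; so a bound relative to the truth is also one relative to the peak.
      have h4 : ENNReal.ofReal (gaussKernel n (σ ^ 2) R) *
          ENNReal.ofReal (√(2 * Real.pi * σ ^ 2) ^ n * Real.exp ((e ⬝ᵥ e) / 2)) = 1 := by
        rw [← ENNReal.ofReal_mul (gaussKernel_pos n (by positivity) _).le, gaussKernel,
          ← ENNReal.ofReal_one]
        congr 1
        have h5 : R / (2 * σ ^ 2) = e ⬝ᵥ e / 2 := by rw [hRdef]; field_simp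
        have h6 : √(2 * Real.pi * σ ^ 2) ≠ 0 := by
          have := Real.pi_pos
          positivity
        rw [h5, Real.exp_neg, inv_pow]
        field_simp
      calc _ = ENNReal.ofReal (gaussKernel n (σ ^ 2) R) * ((∫⁻ θ in B, likelihood X y θ
            ∂(prior p a0 b0 g)) * ENNReal.ofReal (√(2 * Real.pi * σ ^ 2) ^ n *
              Real.exp ((e ⬝ᵥ e) / 2))) := by rw [mul_left_comm, h4, mul_one]
        _ ≤ ENNReal.ofReal pk * q := by
          gcongr
          exact gaussKernel_le_peak hn (by positivity) hR
    calc _ ≤ (ν {θ | likelihood X y θ ≤ ENNReal.ofReal (pk * Real.exp (-(n / 20)))} +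
          ν {θ | likelihood X y θ ≤ ENNReal.ofReal (pk * Real.exp (-(C₃ * ℓ)))}) + ν B := by
          gcongr; exact measure_union_le _ _
      _ ≤ (ENNReal.ofReal pk * ENNReal.ofReal (Real.exp (-(n / 20))) * Z +
          ENNReal.ofReal pk * ENNReal.ofReal (Real.exp (-(C₃ * ℓ))) * Z) + ENNReal.ofReal pk * q := by
          gcongr
          · rw [← ENNReal.ofReal_mul hpk0.le] at h1 ⊢; exact h1
          · rw [← ENNReal.ofReal_mul hpk0.le] at h2 ⊢; exact h2
      _ = _ := by ring
  have hden : ENNReal.ofReal pk * (ENNReal.ofReal (Real.exp (-(1 / 2 + (4 * κ + κ ^ 2) * ℓ))) * d) ≤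
      ∫⁻ θ, likelihood X y θ ∂(prior p a0 b0 g) := by
    rw [← mul_assoc, ← ENNReal.ofReal_mul hpk0.le]
    set c := ENNReal.ofReal (pk * Real.exp (-(1 / 2 + (4 * κ + κ ^ 2) * ℓ)))
    calc c * d ≤ c * prior p a0 b0 g {θ | c ≤ likelihood X y θ} := by
          gcongr
          refine hd.trans (measure_mono fun θ hθ => ?_)
          exact le_likelihood_of_close hn hX hσ hℓ hr he1 he2 hθ.1.1 hθ.1.2 hθ.2
      _ ≤ _ := mul_meas_ge_le_lintegral hlik c
  rw [posterior, Measure.smul_apply, smul_eq_mul]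
  have hpk1 : ENNReal.ofReal pk ≠ 0 := by simpa using hpk0
  calc _ ≤ (ENNReal.ofReal pk *
        (ENNReal.ofReal (Real.exp (-(1 / 2 + (4 * κ + κ ^ 2) * ℓ))) * d))⁻¹ *
        (ENNReal.ofReal pk * ((ENNReal.ofReal (Real.exp (-(n / 20))) +
          ENNReal.ofReal (Real.exp (-(C₃ * ℓ)))) * Z + q)) :=
        mul_le_mul' (ENNReal.inv_le_inv.2 hden) hnum
    _ = _ := by
      rw [mul_comm, ← div_eq_mul_inv, ENNReal.mul_div_mul_left _ _ hpk1 ENNReal.ofReal_ne_top]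

/-- Markov's inequality for the unnormalized posterior mass of a set of small prior
probability. -/
theorem stdGauss_lintegral_likelihood_ge_le {n p : ℕ} (X : Matrix (Fin n) (Fin p) ℝ)
    (βs : Fin p → ℝ) {σ : ℝ} (hσ : 0 < σ) {a0 b0 : ℝ} (ha0 : 0 < a0) (hb0 : 0 < b0) {g : ℝ → ℝ}
    (hg : Measurable g) (hg0 : ∀ x, 0 ≤ g x) (B : Set ((Fin p → ℝ) × ℝ)) {q : ℝ≥0∞} (hq : q ≠ 0)
    (hq' : q ≠ ∞) :
    stdGauss n {e | q ≤ (∫⁻ θ in B, likelihood X (X *ᵥ βs + σ • e) θ ∂(prior p a0 b0 g)) *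
      ENNReal.ofReal (√(2 * Real.pi * σ ^ 2) ^ n * Real.exp ((e ⬝ᵥ e) / 2))} ≤
      prior p a0 b0 g B / q := by
  have : SFinite (prior p a0 b0 g) := by unfold prior; infer_instance
  have hW : Measurable fun e : Fin n → ℝ =>
      ENNReal.ofReal (√(2 * Real.pi * σ ^ 2) ^ n * Real.exp ((e ⬝ᵥ e) / 2)) := by
    have := @measurable_dot_self n
    fun_prop
  have hlik : Measurable fun z : (Fin n → ℝ) × ((Fin p → ℝ) × ℝ) =>
      likelihood X (X *ᵥ βs + σ • z.1) z.2 :=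
    (measurable_likelihood X).comp
      (((measurable_fst.const_smul σ).const_add (X *ᵥ βs)).prodMk measurable_snd)
  have hprod : Measurable fun z : (Fin n → ℝ) × ((Fin p → ℝ) × ℝ) =>
      likelihood X (X *ᵥ βs + σ • z.1) z.2 *
        ENNReal.ofReal (√(2 * Real.pi * σ ^ 2) ^ n * Real.exp ((z.1 ⬝ᵥ z.1) / 2)) :=
    hlik.mul (hW.comp measurable_fst)
  have hN : ∀ e : Fin n → ℝ,
      (∫⁻ θ in B, likelihood X (X *ᵥ βs + σ • e) θ ∂(prior p a0 b0 g)) *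
        ENNReal.ofReal (√(2 * Real.pi * σ ^ 2) ^ n * Real.exp ((e ⬝ᵥ e) / 2)) =
      ∫⁻ θ in B, likelihood X (X *ᵥ βs + σ • e) θ *
        ENNReal.ofReal (√(2 * Real.pi * σ ^ 2) ^ n * Real.exp ((e ⬝ᵥ e) / 2))
          ∂(prior p a0 b0 g) := fun e =>
    (lintegral_mul_const' _ _ ENNReal.ofReal_ne_top).symm
  simp_rw [hN]
  refine (meas_ge_le_lintegral_div hprod.lintegral_prod_right'.aemeasurable hq hq').trans ?_
  gcongr
  -- By Tonelli the mean of the weighted mass of `B` is at most its prior mass, each likelihood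
  -- ratio having mean one for prior-almost every `θ`.
  rw [lintegral_lintegral_swap hprod.aemeasurable]
  calc _ ≤ ∫⁻ _θ in B, 1 ∂(prior p a0 b0 g) := by
        refine lintegral_mono_ae (ae_restrict_of_ae ?_)
        filter_upwards [ae_prior_pos ha0 hb0 hg hg0] with θ hθ
        exact (lintegral_likelihood_ratio X βs hσ θ hθ).le
    _ = _ := by simp

/-- For `σ ≠ 0` the affine map is a measurable embedding, so the formula holds for arbitrary `S` and
the posterior event needs no measurability. -/
theorem dataLaw_apply {n p : ℕ} (X : Matrix (Fin n) (Fin p) ℝ) (β : Fin p → ℝ) {σ : ℝ}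
    (hσ : 0 < σ) (S : Set (Fin n → ℝ)) :
    dataLaw X β σ S = stdGauss n {e | X *ᵥ β + σ • e ∈ S} := by
  have h : MeasurableEmbedding fun e : Fin n → ℝ => X *ᵥ β + σ • e :=
    (measurableEmbedding_addLeft (X *ᵥ β)).comp (measurableEmbedding_const_smul₀ hσ.ne')
  exact h.map_apply _ S

/-! ### Prior mass near the truth -/

theorem integrable_of_integral_eq_one {g : ℝ → ℝ} (hg : ∫ x, g x = 1) : Integrable g := by
  by_contra h
  rw [integral_undef h] at hg
  norm_num at hg

theorem coefLaw_abs_le {g : ℝ → ℝ} (hg0 : ∀ x, 0 ≤ g x) (hg1 : ∫ x, g x = 1) {r : ℝ}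
    (hr : 0 ≤ r) : coefLaw g {z | |z| ≤ r} = ENNReal.ofReal (∫ x in (-r)..r, g x) := by
  have h : {z : ℝ | |z| ≤ r} = Set.Icc (-r) r := by ext; simp [abs_le]
  have hi := integrable_of_integral_eq_one hg1
  rw [h, coefLaw, withDensity_apply _ measurableSet_Icc, intervalIntegral.integral_of_le (by linarith),
    ← integral_Icc_eq_integral_Ioc,
    ofReal_integral_eq_lintegral_ofReal hi.integrableOn (ae_of_all _ hg0)]

theorem coefLaw_lt_abs_le {g : ℝ → ℝ} (hg0 : ∀ x, 0 ≤ g x) (hg1 : ∫ x, g x = 1) {r q : ℝ}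
    (hr : 0 ≤ r) (hq : 1 - ∫ x in (-r)..r, g x ≤ q) :
    coefLaw g {z | r < |z|} ≤ ENNReal.ofReal q := by
  have h : {z : ℝ | r < |z|} = {z | |z| ≤ r}ᶜ := by ext; simp
  have hm : MeasurableSet {z : ℝ | |z| ≤ r} := measurableSet_le (by fun_prop) measurable_const
  have hfin : IsFiniteMeasure (coefLaw g) := ⟨by rw [coefLaw_univ hg0 hg1]; simp⟩
  have hnn : 0 ≤ ∫ x in (-r)..r, g x := intervalIntegral.integral_nonneg (by linarith) fun x _ => hg0 x
  rw [h, measure_compl hm (measure_ne_top _ _), coefLaw_univ hg0 hg1, coefLaw_abs_le hg0 hg1 hr,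
    ← ENNReal.ofReal_one, ← ENNReal.ofReal_sub _ hnn]
  exact ENNReal.ofReal_le_ofReal hq

theorem le_coefLaw_ball {g : ℝ → ℝ} {r m E c : ℝ}
    (hm0 : 0 ≤ m) (hm : ∀ x ∈ Set.Icc (-E) E, m ≤ g x) (hc : |c| + r ≤ E) :
    ENNReal.ofReal (2 * r * m) ≤ coefLaw g {z | |z - c| ≤ r} := by
  have h : {z : ℝ | |z - c| ≤ r} = Set.Icc (c - r) (c + r) := by
    ext z
    simp only [Set.mem_ofPred_eq, abs_le, Set.mem_Icc]
    constructor <;> rintro ⟨h1, h2⟩ <;> constructor <;> linarith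
  rw [h, coefLaw, withDensity_apply _ measurableSet_Icc]
  have hc1 := le_abs_self c
  have hc2 := neg_abs_le c
  calc ENNReal.ofReal (2 * r * m) = ∫⁻ _x in Set.Icc (c - r) (c + r), ENNReal.ofReal m := by
        rw [setLIntegral_const, Real.volume_Icc, ← ENNReal.ofReal_mul hm0]
        congr 1; ring
    _ ≤ _ := by
        refine setLIntegral_mono' measurableSet_Icc fun x hx => ENNReal.ofReal_le_ofReal (hm x ?_)
        exact ⟨by linarith [hx.1], by linarith [hx.2]⟩

/-- Zero coefficients are close with probability at least `1 - q` each, together at least `1 / 2` by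
Bernoulli's inequality and `p q ≤ 1 / 2`. Each nonzero one contributes the interval length `2r`
times the density floor `m`; the variance window contributes its length `t0 / n`. -/
theorem le_prior_close {p n s : ℕ} (hn : 0 < n) {a0 b0 : ℝ} (ha0 : 0 < a0) (hb0 : 0 < b0)
    {g : ℝ → ℝ} (hg : Measurable g) (hg0 : ∀ x, 0 ≤ g x) (hg1 : ∫ x, g x = 1) {βs : Fin p → ℝ}
    (hs : (Finset.univ.filter fun j => βs j ≠ 0).card = s) {r q m E t0 c : ℝ} (hr : 0 ≤ r)
    (hq0 : 0 ≤ q) (hq1 : p * q ≤ 1 / 2) (hq2 : q ≤ 1) (hq : 1 - ∫ x in (-r)..r, g x ≤ q) (hm0 : 0 ≤ m)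
    (hm : ∀ x ∈ Set.Icc (-E) E, m ≤ g x) (hc : 0 ≤ c)
    (hIG : ∀ t ∈ Set.Icc t0 (t0 * (1 + 1 / n)), c ≤ invGammaPDF a0 b0 t)
    (hβ : ∀ t ∈ Set.Icc t0 (t0 * (1 + 1 / n)), ∀ j, |βs j / √t| + r ≤ E) :
    ENNReal.ofReal (c * (t0 / n) * (1 / 2 * (2 * r * m) ^ s)) ≤
      prior p a0 b0 g {θ | θ.2 ∈ Set.Icc t0 (t0 * (1 + 1 / n)) ∧
        ∀ j, θ.1 j / √θ.2 ∈ {z | |z - βs j / √θ.2| ≤ r}} := by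
  have hn' : (0:ℝ) < n := by exact_mod_cast hn
  rw [prior_box ha0 hb0 hg hg0 measurableSet_Icc (fun j t => {z | |z - βs j / √t| ≤ r})
    fun j => measurableSet_le (f := fun z : ℝ × ℝ => |z.1 - βs j / √z.2|) (by fun_prop)
      measurable_const]
  have hhalf : (1:ℝ) / 2 ≤ (1 - q) ^ p := by
    have := one_add_mul_le_pow (a := -q) (by linarith) p
    rw [sub_eq_add_neg]
    linarith
  have hprod : ∀ t ∈ Set.Icc t0 (t0 * (1 + 1 / n)),
      ENNReal.ofReal (1 / 2 * (2 * r * m) ^ s) ≤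
        ∏ j, coefLaw g {z | |z - βs j / √t| ≤ r} := by
    intro t ht
    calc ENNReal.ofReal (1 / 2 * (2 * r * m) ^ s)
        ≤ ENNReal.ofReal (1 - q) ^ p * ENNReal.ofReal (2 * r * m) ^ s := by
          rw [← ENNReal.ofReal_pow (by linarith), ← ENNReal.ofReal_pow (by positivity),
            ← ENNReal.ofReal_mul (pow_nonneg (by linarith) _)]
          apply ENNReal.ofReal_le_ofReal
          gcongr
      -- The factor `1 - q ≤ 1` is charged to the nonzero coordinates too, so that its exponent is
      -- simply `p`.
      _ = ∏ j, (ENNReal.ofReal (1 - q) * if βs j ≠ 0 then ENNReal.ofReal (2 * r * m) else 1) := by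
          rw [Finset.prod_mul_distrib, Finset.prod_const, Finset.card_univ, Fintype.card_fin,
            Finset.prod_ite, Finset.prod_const, Finset.prod_const_one, mul_one, hs]
      _ ≤ _ := by
          refine Finset.prod_le_prod' fun j _ => ?_
          split_ifs with hj
          · refine le_trans ?_ (le_coefLaw_ball hm0 hm (hβ t ht j))
            refine mul_le_of_le_one_left zero_le ?_
            rw [← ENNReal.ofReal_one]
            exact ENNReal.ofReal_le_ofReal (by linarith)
          · rw [not_not] at hj
            rw [mul_one, hj]
            simp only [zero_div, sub_zero]
            rw [coefLaw_abs_le hg0 hg1 hr]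
            exact ENNReal.ofReal_le_ofReal (by linarith)
  calc ENNReal.ofReal (c * (t0 / n) * (1 / 2 * (2 * r * m) ^ s))
      = ∫⁻ _t in Set.Icc t0 (t0 * (1 + 1 / n)),
          ENNReal.ofReal c * ENNReal.ofReal (1 / 2 * (2 * r * m) ^ s) := by
        rw [setLIntegral_const, Real.volume_Icc, ← ENNReal.ofReal_mul hc,
          ← ENNReal.ofReal_mul (by positivity)]
        congr 1; ring
    _ ≤ _ := by
        refine setLIntegral_mono' measurableSet_Icc fun t ht => ?_
        exact mul_le_mul' (ENNReal.ofReal_le_ofReal (hIG t ht)) (hprod t ht)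

theorem exists_le_invGammaPDF {a0 b0 : ℝ} (ha0 : 0 < a0) (hb0 : 0 < b0) {x y : ℝ} (hx : 0 < x) :
    ∃ c, 0 < c ∧ ∀ t ∈ Set.Icc x y, c ≤ invGammaPDF a0 b0 t := by
  rcases lt_or_ge y x with h | hxy
  · exact ⟨1, one_pos, fun t ht => absurd (ht.1.trans ht.2) (not_le.2 h)⟩
  have hG := Real.Gamma_pos_of_pos ha0
  have hy : 0 < y := hx.trans_le hxy
  refine ⟨b0 ^ a0 / Real.Gamma a0 * y ^ (-(a0 + 1)) * Real.exp (-(b0 / x)), by positivity, ?_⟩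
  rintro t ⟨h1, h2⟩
  have ht : 0 < t := hx.trans_le h1
  rw [invGammaPDF, if_pos ht]
  gcongr ?_ * ?_ * Real.exp (-(?_))
  · exact Real.rpow_le_rpow_of_nonpos ht h2 (by linarith)
  · gcongr

/-! ### A finite-sample bound -/

/-- Columns have length at most `√n`. Each tail is `2 exp (-2ℓ)`, and the union over `p ≤ exp ℓ`
columns uses up one `ℓ`. -/
theorem stdGauss_max_dot_ge_le {n p : ℕ} {X : Matrix (Fin n) (Fin p) ℝ} {ℓ : ℝ} (hn : 0 < n)
    (hX : ∀ i j, |X i j| ≤ 1) (hℓ : 0 ≤ ℓ) (hp : p ≤ Real.exp ℓ) :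
    stdGauss n (⋃ j : Fin p, {e : Fin n → ℝ | 2 * √n * √ℓ ≤ |Xᵀ j ⬝ᵥ e|}) ≤
      ENNReal.ofReal (2 * Real.exp (-ℓ)) := by
  have hn' : (0:ℝ) < n := by exact_mod_cast hn
  refine (measure_iUnion_le _).trans ?_
  rw [tsum_fintype]
  have hsn : 0 < √(n:ℝ) := Real.sqrt_pos.2 hn'
  have hterm : ∀ j : Fin p, stdGauss n {e | 2 * √n * √ℓ ≤ |Xᵀ j ⬝ᵥ e|} ≤
      ENNReal.ofReal (2 * Real.exp (-(2 * ℓ))) := by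
    intro j
    rw [ENNReal.ofReal_mul (by norm_num), ENNReal.ofReal_ofNat]
    refine stdGauss_dot_ge_le (Xᵀ j) hsn ?_ hℓ
    rw [Real.sq_sqrt hn'.le]
    calc _ ≤ ∑ _i : Fin n, (1:ℝ) := Finset.sum_le_sum fun i _ => by
          have := abs_le.1 (hX i j)
          simp only [Matrix.transpose_apply]
          nlinarith
      _ = n := by simp
  refine (Finset.sum_le_sum fun j _ => hterm j).trans ?_
  rw [Finset.sum_const, Finset.card_univ, Fintype.card_fin, nsmul_eq_mul,
    ← ENNReal.ofReal_natCast, ← ENNReal.ofReal_mul (Nat.cast_nonneg _)]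
  apply ENNReal.ofReal_le_ofReal
  calc (p:ℝ) * (2 * Real.exp (-(2 * ℓ))) ≤ Real.exp ℓ * (2 * Real.exp (-(2 * ℓ))) := by gcongr
    _ = 2 * (Real.exp ℓ * Real.exp (-(2 * ℓ))) := by ring
    _ = _ := by rw [← Real.exp_add]; congr 2; ring

set_option maxHeartbeats 800000 in
/-- Finite-sample posterior contraction: with high probability, the posterior probability of a set of
parameters far from the truth is at most `exp (-ℓ)`. -/
theorem dataLaw_posterior_ge_le {n p : ℕ} {X : Matrix (Fin n) (Fin p) ℝ} {βs : Fin p → ℝ}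
    {σ ℓ κ r δ : ℝ} {k s : ℕ} {lam C₀ C₃ CP H A a0 b0 : ℝ} {g : ℝ → ℝ} {Z : ℝ}
    (ha0 : 0 < a0) (hb0 : 0 < b0) (hg : Measurable g) (hg0 : ∀ x, 0 ≤ g x) (hg1 : ∫ x, g x = 1)
    (hZ : ∫⁻ t, ENNReal.ofReal (invGammaPDF a0 b0 t) ≤ ENNReal.ofReal Z) (hZ0 : 0 ≤ Z)
    (hn : 0 < n) (hX : ∀ i j, |X i j| ≤ 1) (hσ : 0 < σ) (hℓ : 1 / 2 ≤ ℓ) (hr0 : 0 ≤ r)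
    (hκ : 0 ≤ κ) (hr : √n * (p * r) ≤ κ * √ℓ) (hδ0 : 0 < δ) (hδ : δ ≤ 1 / 4)
    (hlam0 : 0 ≤ lam)
    (hlam : ∀ (T : Finset (Fin p)) (v : Fin p → ℝ), T.card ≤ k + s → (∀ j ∉ T, v j = 0) →
      n * lam * (v ⬝ᵥ v) ≤ (X *ᵥ v) ⬝ᵥ (X *ᵥ v))
    (hs : (Finset.univ.filter fun j => βs j ≠ 0).card = s) (hs1 : 1 ≤ s)
    (hH : 2 * κ ≤ H) (hAH : A ^ 2 * (k + s) ≤ lam * (H - 2 * κ) ^ 2 * s)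
    (hAC : 64 * C₀ ≤ A ^ 2) (hAC3 : 8 * C₃ ≤ A ^ 2 / 4 - 8 * κ - 4 * κ ^ 2) (hC₃ : 0 ≤ C₃)
    (hCP : CP + 4 * κ + κ ^ 2 + 3 ≤ C₃) (hnℓ : C₃ * ℓ ≤ n / 20) (hnδ : ℓ ≤ δ ^ 2 / 16 * n)
    (hpℓ : p ≤ Real.exp ℓ) (hpk : p ^ (k + s) * Real.exp ((k + s : ℕ) / 2 - C₀ * ℓ / 4) ≤ Real.exp (-ℓ))
    (htail : (p * coefLaw g {z | r < |z|}) ^ k ≤ ENNReal.ofReal (Real.exp (-((C₃ + 1) * ℓ))))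
    (hZℓ : 2 * Z + 1 < Real.exp ℓ) (hZℓ2 : 5 + Z ≤ Real.exp (ℓ / 2))
    (hbox : ∀ t0 : ℝ, t0 ∈ Set.Icc ((1 - δ) * σ ^ 2) ((1 + δ) * σ ^ 2) →
      ENNReal.ofReal (Real.exp (-(CP * ℓ))) ≤
        prior p a0 b0 g {θ | θ.2 ∈ Set.Icc t0 (t0 * (1 + 1 / n)) ∧
        ∀ j, θ.1 j / √θ.2 ∈ {z | |z - βs j / √θ.2| ≤ r}})
    (F : Set ((Fin p → ℝ) × ℝ))
    (hF : ∀ θ ∈ F, H * σ * √(ℓ / n) ≤ l2norm (θ.1 - βs) ∨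
      H * σ * √s * √(ℓ / n) ≤ l1norm (θ.1 - βs)) :
    dataLaw X βs σ {y | ENNReal.ofReal (Real.exp (-ℓ)) ≤ posterior X a0 b0 g y F} ≤
      ENNReal.ofReal (Real.exp (-(ℓ / 2))) := by
  have hn' : (0:ℝ) < n := by exact_mod_cast hn
  have hℓ0 : 0 ≤ ℓ := by linarith
  rw [dataLaw_apply X βs hσ]
  set q := ENNReal.ofReal (Real.exp (-(C₃ * ℓ))) with hqdef
  set B := {θ : (Fin p → ℝ) × ℝ | k ≤ (Finset.univ.filter fun j => r < |θ.1 j / √θ.2|).card}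
  set S1 := {e : Fin n → ℝ | δ * n ≤ |e ⬝ᵥ e - n|} with hS1
  set S2 := ⋃ j : Fin p, {e : Fin n → ℝ | 2 * √n * √ℓ ≤ |Xᵀ j ⬝ᵥ e|} with hS2
  set S3 := {e : Fin n → ℝ | ∃ (T : Finset (Fin p)) (v : Fin p → ℝ), T.card ≤ k + s ∧
    (∀ j ∉ T, v j = 0) ∧ C₀ * ℓ * ((X *ᵥ v) ⬝ᵥ (X *ᵥ v)) < ((X *ᵥ v) ⬝ᵥ e) ^ 2} with hS3
  set S4 := {e : Fin n → ℝ | q ≤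
    (∫⁻ θ in B, likelihood X (X *ᵥ βs + σ • e) θ ∂(prior p a0 b0 g)) *
      ENNReal.ofReal (√(2 * Real.pi * σ ^ 2) ^ n * Real.exp ((e ⬝ᵥ e) / 2))} with hS4
  -- The exceptional noise is one of four kinds: bad length `S1`, correlation with a column `S2`,
  -- correlation with a sparse combination `S3`, too much mass on coefficient vectors with many
  -- large entries `S4`.
  have hsub : {e : Fin n → ℝ | X *ᵥ βs + σ • e ∈
      {y | ENNReal.ofReal (Real.exp (-ℓ)) ≤ posterior X a0 b0 g y F}} ⊆
      ((S1 ∪ S2) ∪ S3) ∪ S4 := by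
    intro e he
    by_contra hcon
    simp only [Set.mem_union, not_or] at hcon
    obtain ⟨⟨⟨h1, h2⟩, h3⟩, h4⟩ := hcon
    simp only [hS1, Set.mem_ofPred_eq, not_le] at h1
    simp only [hS2, Set.mem_iUnion, Set.mem_ofPred_eq, not_exists, not_le] at h2
    simp only [hS4, Set.mem_ofPred_eq, not_le] at h4
    have he3 : ∀ (T : Finset (Fin p)) (v : Fin p → ℝ), T.card ≤ k + s → (∀ j ∉ T, v j = 0) →
        ((X *ᵥ v) ⬝ᵥ e) ^ 2 ≤ C₀ * ℓ * ((X *ᵥ v) ⬝ᵥ (X *ᵥ v)) := by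
      intro T v hT hv
      by_contra hlt
      exact h3 ⟨T, v, hT, hv, not_le.1 hlt⟩
    have h1' := abs_lt.1 h1
    -- The variance window is random; off `S1` its left end lies in the deterministic range where
    -- `hbox` holds.
    have hd := hbox (σ ^ 2 * (e ⬝ᵥ e) / n) ⟨by
      rw [le_div_iff₀ hn']; nlinarith [sq_nonneg σ], by
      rw [div_le_iff₀ hn']; nlinarith [sq_nonneg σ]⟩
    have hpost := posterior_le_of_good ha0 hb0 hg hg0 hg1 hn hX hσ hℓ0 hr0 hκ hr
      (h1.le.trans (by gcongr)) (fun j => (h2 j).le) he3 hlam0 hlam hs hs1 hH hAH hAC hAC3 hC₃ F hF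
      h4.le hd
    refine absurd (he.trans hpost) (not_le.2 ?_)
    rw [← ENNReal.ofReal_mul (Real.exp_pos _).le, ← Real.exp_add, ← ENNReal.ofReal_add
      (Real.exp_pos _).le (Real.exp_pos _).le]
    calc _ ≤ (ENNReal.ofReal (2 * Real.exp (-(C₃ * ℓ))) * ENNReal.ofReal Z + q) /
          ENNReal.ofReal (Real.exp (-(1 / 2 + (4 * κ + κ ^ 2) * ℓ) + -(CP * ℓ))) := by
          gcongr
          have : Real.exp (-(n / 20)) ≤ Real.exp (-(C₃ * ℓ)) := Real.exp_le_exp.2 (by linarith)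
          linarith
      _ = ENNReal.ofReal ((2 * Z + 1) * Real.exp (-(C₃ * ℓ) + (1 / 2 + (4 * κ + κ ^ 2) * ℓ) +
            CP * ℓ)) := by
          rw [hqdef, ← ENNReal.ofReal_mul (by positivity), ← ENNReal.ofReal_add (by positivity)
            (by positivity), ← ENNReal.ofReal_div_of_pos (Real.exp_pos _)]
          congr 1
          rw [div_eq_iff (Real.exp_pos _).ne', mul_assoc (2 * Z + 1), ← Real.exp_add]
          have : -(C₃ * ℓ) + (1 / 2 + (4 * κ + κ ^ 2) * ℓ) + CP * ℓ +
            (-(1 / 2 + (4 * κ + κ ^ 2) * ℓ) + -(CP * ℓ)) = -(C₃ * ℓ) := by ring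
          rw [this]; ring
      _ < ENNReal.ofReal (Real.exp (-ℓ)) := by
          refine (ENNReal.ofReal_lt_ofReal_iff (Real.exp_pos _)).2 ?_
          -- Here `hCP` has a margin of `3ℓ`: one `ℓ` is the claimed rate, one absorbs `2 * Z + 1`,
          -- and the last covers the `1 / 2`.
          have h5 : -(C₃ * ℓ) + (1 / 2 + (4 * κ + κ ^ 2) * ℓ) + CP * ℓ ≤ -ℓ - ℓ := by
            nlinarith [mul_le_mul_of_nonneg_right hCP hℓ0]
          calc _ ≤ (2 * Z + 1) * Real.exp (-ℓ - ℓ) := by gcongr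
            _ < Real.exp ℓ * Real.exp (-ℓ - ℓ) := by gcongr
            _ = _ := by rw [← Real.exp_add]; congr 1; ring
  have hP1 : stdGauss n S1 ≤ ENNReal.ofReal (2 * Real.exp (-ℓ)) := by
    refine (stdGauss_normSq_le hδ0 (by linarith)).trans ?_
    rw [ENNReal.ofReal_mul (by norm_num)]
    simp only [ENNReal.ofReal_ofNat]
    gcongr
  have hP2 : stdGauss n S2 ≤ ENNReal.ofReal (2 * Real.exp (-ℓ)) :=
    stdGauss_max_dot_ge_le hn hX hℓ0 hpℓ
  have hP3 : stdGauss n S3 ≤ ENNReal.ofReal (Real.exp (-ℓ)) := by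
    refine (stdGauss_sparse_dot_le X (k + s)).trans ?_
    rw [← ENNReal.ofReal_natCast, ← ENNReal.ofReal_pow (Nat.cast_nonneg _),
      ← ENNReal.ofReal_mul (by positivity)]
    exact ENNReal.ofReal_le_ofReal hpk
  have hP4 : stdGauss n S4 ≤ ENNReal.ofReal (Z * Real.exp (-ℓ)) := by
    refine (stdGauss_lintegral_likelihood_ge_le X βs hσ ha0 hb0 hg hg0 B
      (by simp [Real.exp_pos]) ENNReal.ofReal_ne_top).trans ?_
    calc _ ≤ (ENNReal.ofReal (Real.exp (-((C₃ + 1) * ℓ))) * ENNReal.ofReal Z) / q := by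
          gcongr
          refine (prior_many_large_le ha0 hb0 hg hg0 hg1 r k).trans ?_
          gcongr
      _ = _ := by
          rw [hqdef, ← ENNReal.ofReal_mul (Real.exp_pos _).le,
            ← ENNReal.ofReal_div_of_pos (Real.exp_pos _)]
          congr 1
          rw [div_eq_iff (Real.exp_pos _).ne', mul_assoc, ← Real.exp_add, mul_comm]
          congr 2; ring
  refine (measure_mono hsub).trans ?_
  calc _ ≤ ((stdGauss n S1 + stdGauss n S2) + stdGauss n S3) + stdGauss n S4 := by
        refine (measure_union_le _ _).trans (add_le_add ?_ le_rfl)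
        refine (measure_union_le _ _).trans (add_le_add ?_ le_rfl)
        exact measure_union_le _ _
    _ ≤ ((ENNReal.ofReal (2 * Real.exp (-ℓ)) + ENNReal.ofReal (2 * Real.exp (-ℓ))) +
        ENNReal.ofReal (Real.exp (-ℓ))) + ENNReal.ofReal (Z * Real.exp (-ℓ)) := by gcongr
    _ = ENNReal.ofReal ((5 + Z) * Real.exp (-ℓ)) := by
        rw [← ENNReal.ofReal_add (by positivity) (by positivity),
          ← ENNReal.ofReal_add (by positivity) (by positivity),
          ← ENNReal.ofReal_add (by positivity) (by positivity)]
        congr 1; ring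
    _ ≤ _ := by
        apply ENNReal.ofReal_le_ofReal
        calc (5 + Z) * Real.exp (-ℓ) ≤ Real.exp (ℓ / 2) * Real.exp (-ℓ) := by gcongr
          _ = _ := by rw [← Real.exp_add]; congr 1; ring

/-! ### Asymptotics -/

theorem sparsity_eq_card {m : ℕ} (v : Fin m → ℝ) :
    sparsity v = (Finset.univ.filter fun j => v j ≠ 0).card := by
  rw [sparsity, Set.ncard_eq_toFinset_card']
  simp

/-- A prior that concentrates on `[-r, r]` can do so only for positive `r`. -/
theorem pos_of_concentration {g : ℝ → ℝ} (hg0 : ∀ x, 0 ≤ g x) {r q : ℝ} (hq1 : q < 1)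
    (hq : 1 - ∫ x in (-r)..r, g x ≤ q) : 0 < r := by
  by_contra! h
  have : ∫ x in (-r)..r, g x ≤ 0 := by
    rw [intervalIntegral.integral_symm]
    have := intervalIntegral.integral_nonneg (f := g) (μ := volume) (show r ≤ -r by linarith)
      fun x _ => hg0 x
    linarith
  linarith

/-- The density floor holds only on `[-E, E]`, and coefficients are rescaled by `√t` rather than
`σ`. For `t` this close to `σ²` the factor `γ` worsens at most to `(1 + γ) / 2`, because `γ ≤ ((1 +
γ) / 2)²`; the remaining `(1 - γ) / 2 * E` is room for `r`. -/
theorem abs_div_sqrt_add_le {b σ γ E r t : ℝ} (hσ : 0 < σ) (hγ0 : 0 < γ)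
    (hE : 0 ≤ E) (hb : |b / σ| ≤ γ * E) (ht : (1 - (1 - γ) / 4) * σ ^ 2 ≤ t) (hγ1 : γ < 1)
    (hr : r ≤ (1 - γ) / 2 * E) : |b / √t| + r ≤ E := by
  have ht0 : 0 < t := lt_of_lt_of_le (by have : 0 < 1 - (1 - γ) / 4 := by linarith
                                         positivity) ht
  have hst : 0 < √t := Real.sqrt_pos.2 ht0
  have h1 : γ * σ ≤ (1 + γ) / 2 * √t := by
    refine le_of_sq_le_sq ?_ (by positivity)
    rw [mul_pow, mul_pow, Real.sq_sqrt ht0.le]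
    have h2 : γ ≤ ((1 + γ) / 2) ^ 2 := by nlinarith [sq_nonneg (1 - γ)]
    have h3 : γ * σ ^ 2 ≤ t := by nlinarith [sq_nonneg σ]
    calc γ ^ 2 * σ ^ 2 = γ * (γ * σ ^ 2) := by ring
      _ ≤ ((1 + γ) / 2) ^ 2 * t := by gcongr
  rw [abs_div, abs_of_pos hσ, div_le_iff₀ hσ] at hb
  have h4 : |b / √t| ≤ (1 + γ) / 2 * E := by
    rw [abs_div, abs_of_pos hst, div_le_iff₀ hst]
    nlinarith [mul_le_mul_of_nonneg_left h1 hE]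
  linarith

/-- The lower bound on the prior mass near the truth, in terms of `ℓ = s log p`. -/
theorem exp_le_mass {n p s : ℕ} {c t0 τ r m κ C D : ℝ} (hn : 0 < n) (hp : 0 < p) (hs : 1 ≤ s)
    (hlog : 1 ≤ Real.log p) (hc : 0 < c) (hτ : 0 < τ) (ht0 : τ ≤ t0) (hC : 0 < C) (hκ : 0 < κ)
    (hnp : n ≤ C * p) (hp1 : 2 * C / (c * τ) ≤ p) (hp2 : C / κ ≤ p)
    (hr : κ * (√(s * Real.log p / n) / p) ≤ r) (hm : Real.exp (-(D * Real.log p)) ≤ m) :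
    Real.exp (-((5 + D) * (s * Real.log p))) ≤ c * (t0 / n) * (1 / 2 * (2 * r * m) ^ s) := by
  have hn' : (1:ℝ) ≤ n := by exact_mod_cast hn
  have hp' : (0:ℝ) < p := by exact_mod_cast hp
  have ht0' : 0 < t0 := hτ.trans_le ht0
  have hs' : (1:ℝ) ≤ s := by exact_mod_cast hs
  have hpe : ∀ k : ℕ, Real.exp (-(k * Real.log p)) = ((p:ℝ) ^ k)⁻¹ := by
    intro k
    rw [Real.exp_neg, Real.exp_nat_mul, Real.exp_log hp']
  have hℓ : 1 ≤ s * Real.log p := by nlinarith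
  -- Since `n ≤ C p`, every polynomial factor becomes a power of `p`: two powers for the variance
  -- window here, then three for `r` and `D` for `m` per nonzero coefficient.
  have h1 : Real.exp (-(2 * Real.log p)) ≤ c * (t0 / n) * (1 / 2) := by
    have := hpe 2
    push_cast at this
    rw [this]
    rw [div_le_iff₀ (by positivity)] at hp1
    calc ((p:ℝ) ^ 2)⁻¹ ≤ c * (τ / (C * p)) * (1 / 2) := by
          rw [inv_le_iff_one_le_mul₀ (by positivity)]
          have : c * (τ / (C * p)) * (1 / 2) * (p:ℝ) ^ 2 = (p * (c * τ)) / (2 * C) := by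
            field_simp
          rw [this, le_div_iff₀ (by positivity)]
          linarith
      _ ≤ _ := by gcongr
  have h2 : Real.exp (-(3 * Real.log p)) ≤ r := by
    have := hpe 3
    push_cast at this
    rw [this]
    refine le_trans ?_ hr
    rw [div_le_iff₀ hκ] at hp2
    have h3 : 1 / (n:ℝ) ≤ √(s * Real.log p / n) := by
      apply Real.le_sqrt_of_sq_le
      rw [div_pow, one_pow, div_le_div_iff₀ (by positivity) (by positivity)]
      nlinarith [mul_le_mul_of_nonneg_right hℓ (sq_nonneg (n:ℝ))]
    calc ((p:ℝ) ^ 3)⁻¹ ≤ κ * (1 / (C * p) / p) := by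
          rw [inv_le_iff_one_le_mul₀ (by positivity)]
          have : κ * (1 / (C * p) / p) * (p:ℝ) ^ 3 = p * κ / C := by field_simp
          rw [this, le_div_iff₀ hC]
          linarith
      _ ≤ κ * (1 / n / p) := by gcongr
      _ ≤ _ := by gcongr
  have hr0 : 0 < r := (Real.exp_pos _).trans_le h2
  have hm0 : 0 < m := (Real.exp_pos _).trans_le hm
  have h4 : Real.exp (-((3 + D) * (s * Real.log p))) ≤ (2 * r * m) ^ s := by
    have h5 : Real.exp (-((3 + D) * Real.log p)) ≤ 2 * r * m := by
      have : -((3 + D) * Real.log p) = -(3 * Real.log p) + -(D * Real.log p) := by ring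
      rw [this, Real.exp_add]
      calc _ ≤ r * m := by gcongr
        _ ≤ _ := by nlinarith [mul_pos hr0 hm0]
    have h6 : -((3 + D) * (s * Real.log p)) = s * (-((3 + D) * Real.log p)) := by ring
    rw [h6, Real.exp_nat_mul]
    gcongr
  have h7 : Real.exp (-(2 * (s * Real.log p))) ≤ Real.exp (-(2 * Real.log p)) := by
    apply Real.exp_le_exp.2
    nlinarith
  have h8 : -((5 + D) * (s * Real.log p)) =
      -(2 * (s * Real.log p)) + -((3 + D) * (s * Real.log p)) := by ring
  rw [h8, Real.exp_add]
  calc _ ≤ (c * (t0 / n) * (1 / 2)) * (2 * r * m) ^ s := by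
        refine mul_le_mul (h7.trans h1) h4 (Real.exp_pos _).le (by positivity)
    _ = _ := by ring

set_option maxHeartbeats 2000000 in
/-- Posterior contraction along the sequence, for sets of parameters far from the truth. -/
theorem eventually_dataLaw_posterior_ge_le
    (p : ℕ → ℕ) (X : (n : ℕ) → Matrix (Fin n) (Fin (p n)) ℝ)
    (βs : (n : ℕ) → Fin (p n) → ℝ) (σs : ℝ) (hσs : 0 < σs)
    (s : ℕ → ℕ) (hs : ∀ n, s n = sparsity (βs n))
    (hX : ∀ n i j, |X n i j| ≤ 1)
    (hp : (fun n : ℕ => (n : ℝ)) =O[atTop] fun n => (p n : ℝ))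
    (pbar : ℕ → ℕ) (lam0 : ℝ) (hlam0 : 0 < lam0)
    (hpbar : (fun n => (s n : ℝ)) =o[atTop] fun n => (pbar n : ℝ))
    (heig : ∀ᶠ n : ℕ in atTop, ∀ ξ : Finset (Fin (p n)), ξ.card ≤ pbar n →
      MinEigenvalueGE ((subDesign (X n) ξ)ᵀ * subDesign (X n) ξ) (n * lam0))
    (hsparse : (fun n => (s n : ℝ) * Real.log (p n)) =o[atTop] fun n : ℕ => (n : ℝ))
    (E : ℕ → ℝ) (hE : Monotone E) (γ : ℝ) (hγ0 : 0 < γ) (hγ1 : γ < 1)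
    (hsig : ∀ᶠ n in atTop, ∀ j, |βs n j / σs| ≤ γ * E n)
    (a0 b0 : ℝ) (ha0 : 0 < a0) (hb0 : 0 < b0)
    (g : ℕ → ℝ → ℝ) (hgmeas : ∀ n, Measurable (g n)) (hgnonneg : ∀ n x, 0 ≤ g n x)
    (hgint : ∀ n, ∫ x, g n x = 1)
    (u : ℝ) (hu : 0 < u) (a : ℕ → ℝ)
    (ha : a =Θ[atTop] fun n : ℕ => √(s n * Real.log (p n) / n) / p n)
    (hconc : ∀ᶠ n in atTop, 1 - ∫ x in (-a n)..(a n), g n x ≤ (p n : ℝ) ^ (-(1 + u)))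
    (hinf : ∀ᶠ n in atTop, 0 < sInf (g n '' Set.Icc (-E n) (E n)))
    (hthick : (fun n => -Real.log (sInf (g n '' Set.Icc (-E n) (E n))))
      =O[atTop] fun n => Real.log (p n)) :
    ∃ H : ℝ, 0 < H ∧ ∀ᶠ n : ℕ in atTop, ∀ F : Set ((Fin (p n) → ℝ) × ℝ),
      (∀ θ ∈ F, H * σs * √(s n * Real.log (p n) / n) ≤ l2norm (θ.1 - βs n) ∨
        H * σs * √(s n) * √(s n * Real.log (p n) / n) ≤ l1norm (θ.1 - βs n)) →
      dataLaw (X n) (βs n) σs {y | ENNReal.ofReal (Real.exp (-(s n * Real.log (p n)))) ≤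
        posterior (X n) a0 b0 (g n) y F} ≤
        ENNReal.ofReal (Real.exp (-(s n * Real.log (p n) / 2))) := by
  obtain ⟨C, hC, hCp⟩ := hp.exists_pos
  obtain ⟨κ, hκ, hκa⟩ := ha.1.exists_pos
  obtain ⟨κ', hκ', hκa'⟩ := ha.2.exists_pos
  obtain ⟨D, hD, hDm⟩ := hthick.exists_pos
  rw [IsBigOWith] at hCp hκa hκa' hDm
  obtain ⟨c, hc, hcIG⟩ := exists_le_invGammaPDF ha0 hb0 (x := 1 / 2 * σs ^ 2) (y := 4 * σs ^ 2)
    (by positivity)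
  set Z := (∫⁻ t, ENNReal.ofReal (invGammaPDF a0 b0 t)).toReal with hZdef
  have hZ : ∫⁻ t, ENNReal.ofReal (invGammaPDF a0 b0 t) ≤ ENNReal.ofReal Z :=
    (ENNReal.ofReal_toReal (lintegral_invGammaPDF_lt_top ha0 hb0).ne).ge
  have hZ0 : 0 ≤ Z := ENNReal.toReal_nonneg
  set δ := (1 - γ) / 4 with hδdef
  have hδ0 : 0 < δ := by rw [hδdef]; linarith
  have hδ1 : δ ≤ 1 / 4 := by rw [hδdef]; linarith
  set CP := 5 + D with hCP
  set C₃ := CP + 4 * κ + κ ^ 2 + 3 with hC₃def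
  have hC₃ : 0 < C₃ := by positivity
  -- With `k = K s`, the prior mass bound `p ^ (-u k)` is at most `exp (-(C₃ + 1) ℓ)`, which beats
  -- the level `exp (-C₃ ℓ)` in Markov's inequality.
  set K := ⌈(C₃ + 1) / u⌉₊ with hKdef
  have hK : C₃ + 1 ≤ u * K := by
    have := Nat.le_ceil ((C₃ + 1) / u)
    rw [div_le_iff₀ hu] at this
    linarith
  -- `C₀ / 4 = 2 (K + 1) + 1` pays for the `p ^ ((K + 1) s)` supports, the dimension term `(K + 1) s
  -- / 2`, and a final `exp (-ℓ)`.
  set C₀ : ℝ := 8 * (K + 1) + 4 with hC₀def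
  set A := √(64 * C₀ + 32 * C₃ + 32 * κ + 16 * κ ^ 2) with hAdef
  have hA2 : A ^ 2 = 64 * C₀ + 32 * C₃ + 32 * κ + 16 * κ ^ 2 := Real.sq_sqrt (by positivity)
  have hApos : 0 < A ^ 2 := by rw [hA2]; positivity
  set H := 2 * κ + √(A ^ 2 * (K + 1) / lam0) with hHdef
  have hH2 : (H - 2 * κ) ^ 2 = A ^ 2 * (K + 1) / lam0 := by
    rw [hHdef, add_sub_cancel_left, Real.sq_sqrt (by positivity)]
  have hHκ : 2 * κ ≤ H := by rw [hHdef]; linarith [Real.sqrt_nonneg (A ^ 2 * (K + 1) / lam0)]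
  have hC₀ : 0 < C₀ := by positivity
  clear_value H A C₀ K C₃ CP δ Z
  refine ⟨H, by linarith, ?_⟩
  -- the dimension tends to infinity
  have hptop : Tendsto (fun n => (p n : ℝ)) atTop atTop := by
    have h1 : Tendsto (fun n : ℕ => (n : ℝ) / C) atTop atTop :=
      tendsto_natCast_atTop_atTop.atTop_div_const hC
    refine tendsto_atTop_mono' _ ?_ h1
    filter_upwards [hCp] with n hn
    simp only [Real.norm_natCast] at hn
    rw [div_le_iff₀ hC]; linarith
  have hlogtop : Tendsto (fun n => Real.log (p n)) atTop atTop := Real.tendsto_log_atTop.comp hptop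
  -- A nonzero signal at one index forces `E > 0` there, and monotonicity keeps `E` bounded below
  -- from then on; if `s` is eventually zero, nothing is needed.
  have hEpos : ∃ E0, 0 < E0 ∧ ∀ᶠ n in atTop, 0 < s n → E0 ≤ E n := by
    by_cases hev : ∀ᶠ n in atTop, s n = 0
    · exact ⟨1, one_pos, hev.mono fun n hn h => absurd hn h.ne'⟩
    · have hfreq : ∃ᶠ n in atTop, s n ≠ 0 := not_eventually.1 hev
      obtain ⟨n0, hn0, hsn0⟩ := (hfreq.and_eventually hsig).exists
      have : ∃ j, βs n0 j ≠ 0 := by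
        by_contra! hcon
        apply hn0
        rw [hs, sparsity_eq_card, Finset.card_eq_zero, Finset.filter_eq_empty_iff]
        simp [hcon]
      obtain ⟨j, hj⟩ := this
      have h1 : 0 < |βs n0 j / σs| := abs_pos.2 (div_ne_zero hj hσs.ne')
      have h2 : 0 < E n0 := by
        have := h1.trans_le (hsn0 j)
        exact (mul_pos_iff_of_pos_left hγ0).1 this
      exact ⟨E n0, h2, (eventually_ge_atTop n0).mono fun n hn _ => hE hn⟩
  obtain ⟨E0, hE0, hEE0⟩ := hEpos
  have hpu : Tendsto (fun n => (p n : ℝ) ^ (-u)) atTop (nhds 0) :=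
    (tendsto_rpow_neg_atTop hu).comp hptop
  filter_upwards [hCp, hκa, hκa', hDm, heig, hsig, hconc, hinf, hEE0,
    hsparse.bound (show 0 < min (1 / (20 * C₃)) (min (δ ^ 2 / 16) 1) by positivity),
    hpbar.bound (show (0:ℝ) < 1 / (K + 1) by positivity),
    hptop.eventually_ge_atTop 2, hptop.eventually_ge_atTop (2 * C / (c * (1 / 2 * σs ^ 2))),
    hptop.eventually_ge_atTop (C / κ'⁻¹), hptop.eventually_ge_atTop (κ / ((1 - γ) / 2 * E0)),
    hlogtop.eventually_ge_atTop 1, hlogtop.eventually_gt_atTop (Real.log (2 * Z + 1)),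
    hlogtop.eventually_ge_atTop (2 * Real.log (5 + Z)),
    hpu.eventually (ge_mem_nhds (show (0:ℝ) < 1 / 2 by norm_num)), eventually_gt_atTop 0]
    with n hCp hκa hκa' hDm heig hsig hconc hinf hEE0 hsp hpb hp2 hpc hpκ hpE hlog1 hlogZ hlogZ2
      hpu hn
  intro F hF
  have hn' : (0:ℝ) < n := by exact_mod_cast hn
  have hp0 : (0:ℝ) < p n := by linarith
  have hp0' : 0 < p n := by exact_mod_cast hp0
  -- rewriting the hypotheses without norms
  have hpq : (p n : ℝ) * (p n : ℝ) ^ (-(1 + u)) = (p n : ℝ) ^ (-u) := by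
    rw [← Real.rpow_one_add' hp0.le (by linarith)]
    congr 1; ring
  have hq0 : 0 ≤ (p n : ℝ) ^ (-(1 + u)) := Real.rpow_nonneg hp0.le _
  have hq1 : (p n : ℝ) ^ (-(1 + u)) < 1 := by
    have h1 : (p n : ℝ) ^ (-(1 + u)) ≤ p n * (p n : ℝ) ^ (-(1 + u)) :=
      le_mul_of_one_le_left hq0 (by linarith)
    linarith
  have hapos : 0 < a n := pos_of_concentration (hgnonneg n) hq1 hconc
  set b := √(s n * Real.log (p n) / n) / p n with hb
  have hb0' : 0 ≤ b := by positivity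
  rw [Real.norm_of_nonneg hapos.le, Real.norm_of_nonneg hb0'] at hκa hκa'
  -- Concentration forces `a n > 0`, whereas `s n = 0` would make the comparison rate, hence `a n`,
  -- vanish.
  have hs1 : 1 ≤ s n := by
    rw [Nat.one_le_iff_ne_zero]
    intro h0
    have : b = 0 := by simp [hb, h0]
    rw [this] at hκa
    linarith
  have hs1' : (1:ℝ) ≤ s n := by exact_mod_cast hs1
  have hEn := hEE0 hs1
  set ℓ := (s n : ℝ) * Real.log (p n) with hℓdef
  have hℓlog : Real.log (p n) ≤ ℓ := by
    rw [hℓdef]; exact le_mul_of_one_le_left (by linarith) hs1'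
  have hℓ1 : 1 ≤ ℓ := hlog1.trans hℓlog
  rw [Real.norm_of_nonneg (by linarith), Real.norm_natCast] at hsp
  have hsp1 : ℓ ≤ 1 / (20 * C₃) * n := hsp.trans (by gcongr; exact min_le_left _ _)
  have hsp2 : ℓ ≤ δ ^ 2 / 16 * n :=
    hsp.trans (by gcongr; exact (min_le_right _ _).trans (min_le_left _ _))
  have hsp3 : ℓ ≤ 1 * n :=
    hsp.trans (by gcongr; exact (min_le_right _ _).trans (min_le_right _ _))
  rw [Real.norm_natCast, Real.norm_natCast] at hpb
  have hks : K * s n + s n ≤ pbar n := by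
    have h1 : ((K:ℝ) + 1) * s n ≤ pbar n := by
      rw [one_div, inv_mul_eq_div, le_div_iff₀ (by positivity)] at hpb
      linarith
    have h2 : ((K * s n + s n : ℕ) : ℝ) ≤ pbar n := by push_cast; linarith
    exact_mod_cast h2
  have hcard : (Finset.univ.filter fun j => βs n j ≠ 0).card = s n := by
    rw [hs, sparsity_eq_card]
  have hsqrt : √(n:ℝ) * √(ℓ / n) = √ℓ := by
    rw [← Real.sqrt_mul hn'.le, mul_div_cancel₀ _ hn'.ne']
  have hr : √n * (p n * a n) ≤ κ * √ℓ := by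
    calc √n * (p n * a n) ≤ √n * (p n * (κ * b)) := by gcongr
      _ = κ * (√n * √(ℓ / n)) := by rw [hb]; field_simp
      _ = _ := by rw [hsqrt]
  have hra : a n ≤ (1 - γ) / 2 * E n := by
    have h1 : b ≤ 1 / p n := by
      rw [hb]
      gcongr
      refine Real.sqrt_le_one.2 ?_
      rw [div_le_one hn']; linarith
    have hE2 : 0 < (1 - γ) / 2 * E0 := by
      have : 0 < 1 - γ := by linarith
      positivity
    calc a n ≤ κ * b := hκa
      _ ≤ κ * (1 / p n) := by gcongr
      _ ≤ (1 - γ) / 2 * E0 := by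
        rw [div_le_iff₀ hE2] at hpE
        rw [mul_one_div, div_le_iff₀ hp0]
        linarith
      _ ≤ _ := by
        have : 0 ≤ 1 - γ := by linarith
        gcongr
  set m := sInf (g n '' Set.Icc (-E n) (E n)) with hmdef
  have hm : ∀ x ∈ Set.Icc (-E n) (E n), m ≤ g n x := fun x hx =>
    csInf_le ⟨0, by rintro _ ⟨z, _, rfl⟩; exact hgnonneg n z⟩ ⟨x, hx, rfl⟩
  have hmD : Real.exp (-(D * Real.log (p n))) ≤ m := by
    rw [← Real.le_log_iff_exp_le hinf]
    have h1 := (le_abs_self _).trans hDm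
    rw [Real.norm_of_nonneg (by linarith)] at h1
    linarith
  simp only [Real.norm_natCast] at hCp
  clear_value m b ℓ
  have hexpp : Real.exp (Real.log (p n)) = p n := Real.exp_log hp0
  refine dataLaw_posterior_ge_le (ℓ := ℓ) (κ := κ) (r := a n) (δ := δ) (k := K * s n) (s := s n)
    (lam := lam0) (C₀ := C₀) (C₃ := C₃) (CP := CP) (H := H) (A := A) (Z := Z) ha0 hb0 (hgmeas n)
    (hgnonneg n) (hgint n) hZ hZ0 hn (hX n) hσs (by linarith) hapos.le hκ.le hr hδ0 hδ1 hlam0.le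
    ?_ hcard hs1 hHκ ?_ ?_ ?_ hC₃.le ?_ ?_ hsp2 ?_ ?_ ?_ ?_ ?_ ?_ F hF
  · intro T v hT hv
    exact minEigenvalueGE_mulVec (X n) T _ (heig T (hT.trans hks)) v hv
  · rw [hH2]
    push_cast
    apply le_of_eq
    field_simp
  · rw [hA2]
    have : 0 ≤ 32 * C₃ + 32 * κ + 16 * κ ^ 2 := by positivity
    linarith
  · rw [hA2]
    linarith
  · rw [hC₃def]
  · calc C₃ * ℓ ≤ C₃ * (1 / (20 * C₃) * n) := by gcongr
      _ = n / 20 := by field_simp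
  · rw [← hexpp]
    exact Real.exp_le_exp.2 hℓlog
  · have h1 : (p n : ℝ) ^ (K * s n + s n) = Real.exp ((K + 1) * ℓ) := by
      conv_lhs => rw [← hexpp]
      rw [← Real.exp_nat_mul]
      congr 1
      push_cast
      rw [hℓdef]; ring
    rw [h1, ← Real.exp_add]
    apply Real.exp_le_exp.2
    have h2 : ((K * s n + s n : ℕ) : ℝ) / 2 ≤ (K + 1) * ℓ := by
      push_cast
      have h3 : (s n : ℝ) ≤ ℓ := by
        rw [hℓdef]; exact le_mul_of_one_le_right (by positivity) hlog1
      have h4 := mul_le_mul_of_nonneg_left h3 (show (0:ℝ) ≤ K + 1 by positivity)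
      have h5 : 0 ≤ ((K:ℝ) + 1) * ℓ := by positivity
      linarith
    have h3 : C₀ * ℓ / 4 = 2 * ((K + 1) * ℓ) + ℓ := by rw [hC₀def]; ring
    linarith
  · have h1 := coefLaw_lt_abs_le (hgnonneg n) (hgint n) hapos.le hconc
    calc _ ≤ ((p n : ℝ≥0∞) * ENNReal.ofReal ((p n : ℝ) ^ (-(1 + u)))) ^ (K * s n) := by gcongr
      _ = ENNReal.ofReal (Real.exp (-(u * K * ℓ))) := by
        rw [← ENNReal.ofReal_natCast, ← ENNReal.ofReal_mul hp0.le, hpq,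
          ← ENNReal.ofReal_pow (Real.rpow_nonneg hp0.le _), Real.rpow_def_of_pos hp0,
          ← Real.exp_nat_mul]
        congr 2
        push_cast
        rw [hℓdef]; ring
      _ ≤ _ := by
        apply ENNReal.ofReal_le_ofReal
        apply Real.exp_le_exp.2
        exact neg_le_neg (mul_le_mul_of_nonneg_right hK (by linarith))
  · rw [← Real.log_lt_iff_lt_exp (by linarith)]
    linarith
  · rw [← Real.log_le_iff_le_exp (by linarith)]
    linarith
  · rintro t0 ⟨ht1, ht2⟩
    have hn1 : (1:ℝ) ≤ n := by exact_mod_cast hn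
    have ht0 : 1 / 2 * σs ^ 2 ≤ t0 :=
      (mul_le_mul_of_nonneg_right (by linarith) (sq_nonneg σs)).trans ht1
    have ht0' : 0 ≤ t0 := le_trans (by positivity) ht0
    have hup : t0 * (1 + 1 / n) ≤ 4 * σs ^ 2 := by
      have : 1 / (n:ℝ) ≤ 1 := by rw [div_le_one hn']; exact hn1
      calc t0 * (1 + 1 / n) ≤ ((1 + δ) * σs ^ 2) * (1 + 1) := by gcongr
        _ = (2 + 2 * δ) * σs ^ 2 := by ring
        _ ≤ _ := mul_le_mul_of_nonneg_right (by linarith) (sq_nonneg σs)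
    refine le_trans (ENNReal.ofReal_le_ofReal ?_) (le_prior_close hn ha0 hb0 (hgmeas n) (hgnonneg n)
      (hgint n) hcard (r := a n) (q := (p n : ℝ) ^ (-(1 + u))) (m := m) (E := E n) (t0 := t0)
      (c := c) hapos.le hq0 (hpq.le.trans hpu) hq1.le hconc hinf.le hm hc.le ?_ ?_)
    · rw [hCP, hℓdef]
      refine exp_le_mass hn hp0' hs1 hlog1 hc (τ := 1 / 2 * σs ^ 2) (by positivity) ht0 hC
        (κ := κ'⁻¹) (by positivity) hCp hpc hpκ ?_ hmD
      rw [inv_mul_le_iff₀ hκ', ← hℓdef, ← hb]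
      exact hκa'
    · intro t ht
      exact hcIG t ⟨ht0.trans ht.1, ht.2.trans hup⟩
    · intro t ht j
      exact abs_div_sqrt_add_le hσs hγ0 (hE0.le.trans hEn) (hsig j)
        (hδdef ▸ ht1.trans ht.1) hγ1 hra

end ShrinkageRegression

theorem theorem1
    -- dimensions, design matrices, true parameters
    (p : ℕ → ℕ) (X : (n : ℕ) → Matrix (Fin n) (Fin (p n)) ℝ)
    (βs : (n : ℕ) → Fin (p n) → ℝ) (σs : ℝ) (hσs : 0 < σs)
    (s : ℕ → ℕ) (hs : ∀ n, s n = ShrinkageRegression.sparsity (βs n))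
    -- conditions on the design
    (hX : ∀ n i j, |X n i j| ≤ 1)
    (hp : (fun n : ℕ => (n : ℝ)) =O[atTop] fun n => (p n : ℝ))
    (pbar : ℕ → ℕ) (lam0 : ℝ) (hlam0 : 0 < lam0)
    (hpbar : (fun n => (s n : ℝ)) =o[atTop] fun n => (pbar n : ℝ))
    (heig : ∀ᶠ n : ℕ in atTop, ∀ ξ : Finset (Fin (p n)), ξ.card ≤ pbar n →
      ShrinkageRegression.MinEigenvalueGE
        ((ShrinkageRegression.subDesign (X n) ξ)ᵀ * ShrinkageRegression.subDesign (X n) ξ)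
        (n * lam0))
    -- conditions on the true coefficients
    (hsparse : (fun n => (s n : ℝ) * Real.log (p n)) =o[atTop] fun n : ℕ => (n : ℝ))
    (E : ℕ → ℝ) (hE : Monotone E) (γ : ℝ) (hγ0 : 0 < γ) (hγ1 : γ < 1)
    (hsig : ∀ᶠ n in atTop, ∀ j, |βs n j / σs| ≤ γ * E n)
    -- the prior
    (a0 b0 : ℝ) (ha0 : 0 < a0) (hb0 : 0 < b0)
    (g : ℕ → ℝ → ℝ) (hgmeas : ∀ n, Measurable (g n)) (hgnonneg : ∀ n x, 0 ≤ g n x)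
    (hgint : ∀ n, ∫ x, g n x = 1)
    (u : ℝ) (hu : 0 < u) (a : ℕ → ℝ)
    (ha : a =Θ[atTop] fun n : ℕ => √(s n * Real.log (p n) / n) / p n)
    (hconc : ∀ᶠ n in atTop, 1 - ∫ x in (-a n)..(a n), g n x ≤ (p n : ℝ) ^ (-(1 + u)))
    (hinf : ∀ᶠ n in atTop, 0 < sInf (g n '' Set.Icc (-E n) (E n)))
    (hthick : (fun n => -Real.log (sInf (g n '' Set.Icc (-E n) (E n))))
      =O[atTop] fun n => Real.log (p n)) :
    ∃ M₀ : ℝ, 0 < M₀ ∧ ∀ M : ℝ, M₀ ≤ M → ∃ c₁ c₂ c₃ : ℝ, 0 < c₁ ∧ 0 < c₂ ∧ 0 < c₃ ∧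
      ∀ᶠ n : ℕ in atTop,
        (ShrinkageRegression.dataLaw (X n) (βs n) σs
          {y | ENNReal.ofReal
                (Real.exp (-(c₂ * n * ShrinkageRegression.rate M n (p n) (s n) ^ 2))) ≤
              ShrinkageRegression.posterior (X n) a0 b0 (g n) y
                {θ | c₁ * σs * ShrinkageRegression.rate M n (p n) (s n) ≤
                  ShrinkageRegression.l2norm (θ.1 - βs n)}} ≤
          ENNReal.ofReal
            (Real.exp (-(c₃ * n * ShrinkageRegression.rate M n (p n) (s n) ^ 2)))) ∧
        (ShrinkageRegression.dataLaw (X n) (βs n) σs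
          {y | ENNReal.ofReal
                (Real.exp (-(c₂ * n * ShrinkageRegression.rate M n (p n) (s n) ^ 2))) ≤
              ShrinkageRegression.posterior (X n) a0 b0 (g n) y
                {θ | c₁ * √(s n) * ShrinkageRegression.rate M n (p n) (s n) * σs ≤
                  ShrinkageRegression.l1norm (θ.1 - βs n)}} ≤
          ENNReal.ofReal
            (Real.exp (-(c₃ * n * ShrinkageRegression.rate M n (p n) (s n) ^ 2)))) := by
  obtain ⟨H, hH, hev⟩ := ShrinkageRegression.eventually_dataLaw_posterior_ge_le p X βs σs hσs s hs hX
    hp pbar lam0 hlam0 hpbar heig hsparse E hE γ hγ0 hγ1 hsig a0 b0 ha0 hb0 g hgmeas hgnonneg hgint u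
    hu a ha hconc hinf hthick
  -- The separation `H` does not depend on `M`, so any positive `M₀` works: the constants chosen
  -- below undo the factor `M` in the rate, and `c₂ n ε²` is exactly `s log p`.
  refine ⟨1, one_pos, fun M hM => ?_⟩
  have hM0 : 0 < M := by linarith
  refine ⟨H / M, 1 / M ^ 2, 1 / (2 * M ^ 2), by positivity, by positivity, by positivity, ?_⟩
  filter_upwards [hev, eventually_gt_atTop 0] with n h hn
  have hn' : (0:ℝ) < n := by exact_mod_cast hn
  have hlog : 0 ≤ Real.log (p n) := Real.log_natCast_nonneg _
  have hrate : ShrinkageRegression.rate M n (p n) (s n) ^ 2 =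
      M ^ 2 * (s n * Real.log (p n) / n) := by
    rw [ShrinkageRegression.rate, mul_pow, Real.sq_sqrt (by positivity)]
  have e1 : 1 / M ^ 2 * n * ShrinkageRegression.rate M n (p n) (s n) ^ 2 =
      s n * Real.log (p n) := by
    rw [hrate]; field_simp
  have e2 : 1 / (2 * M ^ 2) * n * ShrinkageRegression.rate M n (p n) (s n) ^ 2 =
      s n * Real.log (p n) / 2 := by
    rw [hrate]; field_simp
  rw [e1, e2]
  refine ⟨h _ fun θ hθ => Or.inl (le_trans (le_of_eq ?_) hθ),
    h _ fun θ hθ => Or.inr (le_trans (le_of_eq ?_) hθ)⟩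
  · rw [ShrinkageRegression.rate]; field_simp
  · rw [ShrinkageRegression.rate]; field_simp
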